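/- Let $r>0$, let $B=\sqrt2\,W$ with $W$ a standard one-dimensional Brownian motion, and let $N$ be a Poisson process of intensity $r$, with $W$ and $N$ independent. For $x\ge 0$, let $\tau_t$ be the last jump time of $N$ in $[0,t]$ ($\tau_t=0$ if there is none), and let $X^{+}$ be the reflecting Brownian motion with Poissonian resetting at $0$ started at $x$: $$X^+_t=\bigl|\,x\,\mathbf 1_{\{N_t=0\}}+B_t-B_{\tau_t}\bigr| ,$$ that is, $X^+$ is a reflecting Brownian motion (generator $d^2/dx^2$) which is put back to $0$ at each jump of $N$. Write $\mathbf P_x$ for its law and $P^+_tf(x)=\mathbf E_x[f(X^+_t)]$. Let $\mu^+(dx)=\sqrt r\,e^{-\sqrt r x}\,dx$ on $(0,\infty)$ and $\langle f,g\rangle_{\mu^+}=\int_0^\infty f g\,d\mu^+$, and let $\mathbf P_{\mu^+}$ be the law of $X^+$ when the starting point is random with law $\mu^+$ and independent of $(W,N)$. Fix $T>0$ and put $X^R_t=X^+_{T-t}$, $0\le t\le T$. Let $\mathbf P_x(X^R_t\in dy)=\mathbf P_{\mu^+}(X^R_t\in dy\mid X^R_0=x)$, defined for $\mu^+$-almost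 every $x$, and $P^R_tg(x)=\int g(y)\,\mathbf P_x(X^R_t\in dy)$. **Proposition.** (0) Under $\mathbf P_{\mu^+}$, $(X^R_t)_{0\le t\le T}$ is a time-homogeneous Markov process with transition operators $P^R_t$: for $s+t\le T$ and $g$ bounded measurable, $\mathbf E_{\mu^+}[g(X^R_{s+t})\mid \sigma(X^R_u,u\le s)]=P^R_tg(X^R_s)$ almost surely. (1) For every $t\in[0,T]$, as measures in $(x,y)$, $$\mu^+(dx)\,\mathbf P_x(X^R_t\in dy)=\mu^+(dy)\,\mathbf P_y(X^+_t\in dx).$$ (2) For every $t\in[0,T]$ and all bounded measurable $f,g$, $\langle P^+_tf,g\rangle_{\mu^+}=\langle f,P^R_tg\rangle_{\mu^+}$. (3) Let $(A^+,D(A^+))$ and $(A^R,D(A^R))$ be the generators of $P^+$ and $P^R$ in $L^2(\mu^+)$, i.e. $f\in D(A)$ and $Af=h$ if $f,h\in L^2(\mu^+)$ and $(P_tf-f)/t\to h$ in $L^2(\mu^+)$ as $t\downarrow0$. Then $\langle A^+f,g\rangle_{\mu^+}=\langle f,A^Rg\rangle_{\mu^+}$ for all $f\in D(A^+)$ and $g\in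 D(A^R)$. Moreover $D(A^+)$ contains every $f\in C[0,\infty)\cap C^2(0,\infty)$ with $f$, $f''$ bounded and $f'(0)=0$, and for such $f$, $A^+f(x)=f''(x)+r\,(f(0)-f(x))$. -/

import Mathlib

open MeasureTheory ProbabilityTheory Filter Topology Set
open scoped NNReal ENNReal

noncomputable section

namespace ResettingBM

/-- `N` is a Poisson process of intensity `r`: it starts at `0`, has independent increments with
`N t - N s` Poisson distributed of parameter `r (t - s)`, and almost all of its paths are
nondecreasing and right-continuous. -/
structure IsPoissonProcess {Ω : Type*} [MeasurableSpace Ω] (N : ℝ≥0 → Ω → ℕ) (r : ℝ≥0)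
    (P : Measure Ω) : Prop where
  zero : ∀ᵐ ω ∂P, N 0 ω = 0
  indep : HasIndepIncrements N P
  law : ∀ s t : ℝ≥0, s ≤ t →
    HasLaw (fun ω => N t ω - N s ω) (poissonMeasure (r * (t - s))) P
  mono : ∀ᵐ ω ∂P, Monotone (fun t => N t ω)
  rightCont : ∀ᵐ ω ∂P, ∀ t, ContinuousWithinAt (fun u => N u ω) (Ici t) t

/-- The last jump time in `[0, t]` of a right-continuous counting path `n` (it is `0` if there is
no jump up to time `t`): the first time at which `n` has reached the value `n t`. -/
def lastJump (n : ℝ≥0 → ℕ) (t : ℝ≥0) : ℝ≥0 := sInf {s | n s = n t}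

/-- The path started at `x` that follows the increments of `b` and is put to `0` at every jump of
the counting path `n`; it solves `dZ = db - Z dn`, `Z 0 = x`, when `b 0 = 0` and `n 0 = 0`. -/
def resetPath (x : ℝ) (b : ℝ≥0 → ℝ) (n : ℝ≥0 → ℕ) (t : ℝ≥0) : ℝ :=
  (if n t = 0 then x else 0) + (b t - b (lastJump n t))

/-- The reflecting Brownian motion `X⁺` with resetting at `0` at the jumps of `N`, started at the
random point `ξ`. It is driven by `B = √2 W` (so that `B t` has variance `2 t` and its generator is
`d²/dx²`), and the reflection is `B⁺ = |B|`. -/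
def resetRBM {Ω : Type*} (ξ : Ω → ℝ) (W : ℝ≥0 → Ω → ℝ) (N : ℝ≥0 → Ω → ℕ) (t : ℝ≥0) (ω : Ω) : ℝ :=
  |resetPath (ξ ω) (fun s => √2 * W s ω) (fun s => N s ω) t|

/-- `P_x(X⁺_t ∈ dy)`: the law at time `t` of the process started at the point `x`. -/
def forwardLaw {Ω : Type*} [MeasurableSpace Ω] (P : Measure Ω) (W : ℝ≥0 → Ω → ℝ)
    (N : ℝ≥0 → Ω → ℕ) (t : ℝ≥0) (x : ℝ) : Measure ℝ :=
  P.map (resetRBM (fun _ => x) W N t)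

/-- Time reversal on `[0, T]`: `X^R_t = X_{T-t}` (used for `t ≤ T`). -/
def timeReversal {Ω : Type*} (T : ℝ≥0) (X : ℝ≥0 → Ω → ℝ) (t : ℝ≥0) (ω : Ω) : ℝ :=
  X (T - t) ω

/-- The conditional law `P(Y_t ∈ dy | Y_0 = x)`. -/
def condLaw {Ω : Type*} [MeasurableSpace Ω] (P : Measure Ω) [IsFiniteMeasure P]
    (Y : ℝ≥0 → Ω → ℝ) (t : ℝ≥0) (x : ℝ) : Measure ℝ :=
  condDistrib (Y t) (Y 0) P x

/-- The operators `κ_t f (x) = ∫ f(y) κ_t(x, dy)` of a family of transition laws. -/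
def semigroup (κ : ℝ≥0 → ℝ → Measure ℝ) (t : ℝ≥0) (f : ℝ → ℝ) (x : ℝ) : ℝ :=
  ∫ y, f y ∂(κ t x)

/-- Bounded measurable functions. -/
def BddMeas {α : Type*} [MeasurableSpace α] (f : α → ℝ) : Prop :=
  Measurable f ∧ ∃ C : ℝ, ∀ x, |f x| ≤ C

/-- `(Y_t)_{0 ≤ t ≤ T}` is a time-homogeneous Markov process with transition laws `κ`:
`E[g(Y_{s+t}) | σ(Y_u, u ≤ s)] = (κ_t g)(Y_s)` for all bounded measurable `g`, the conditional
expectation being tested against the bounded measurable functionals of `(Y_u)_{u ≤ s}`. -/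
def IsMarkovWith {Ω : Type*} [MeasurableSpace Ω] (P : Measure Ω) (T : ℝ≥0) (Y : ℝ≥0 → Ω → ℝ)
    (κ : ℝ≥0 → ℝ → Measure ℝ) : Prop :=
  ∀ s t : ℝ≥0, s + t ≤ T → ∀ F : (Iic s → ℝ) → ℝ, BddMeas F → ∀ g : ℝ → ℝ, BddMeas g →
    ∫ ω, F (fun u => Y u ω) * g (Y (s + t) ω) ∂P =
      ∫ ω, F (fun u => Y u ω) * semigroup κ t g (Y s ω) ∂P

/-- `f` is in the domain of the `L²(μ)`-generator of `S`, with value `h`: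
`(S_t f - f) / t → h` in `L²(μ)` as `t ↓ 0`. -/
def IsGenerator (μ : Measure ℝ) (S : ℝ≥0 → (ℝ → ℝ) → ℝ → ℝ) (f h : ℝ → ℝ) : Prop :=
  MemLp f 2 μ ∧ MemLp h 2 μ ∧
    Tendsto (fun t : ℝ≥0 => eLpNorm (fun x => (S t f x - f x) / t - h x) 2 μ) (𝓝[>] 0) (𝓝 0)

/-- The operator `A⁺ f = f'' + r (f(0) - f)` on `(0, ∞)`. -/
def opA (r : ℝ≥0) (f : ℝ → ℝ) (x : ℝ) : ℝ :=
  deriv (deriv f) x + r * (f 0 - f x)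

/-- The explicit domain of `A⁺`: `f ∈ C[0,∞) ∩ C²(0,∞)` with `f'(0) = 0`, where (as for the
generator of a semigroup acting on bounded functions) `f` and `A⁺ f`, that is, `f` and `f''`,
are bounded. -/
structure DomA (f : ℝ → ℝ) : Prop where
  cont : ContinuousOn f (Ici 0)
  smooth : ContDiffOn ℝ 2 f (Ioi 0)
  neumann : HasDerivWithinAt f 0 (Ici 0) 0
  bdd : ∃ C : ℝ, ∀ x, 0 ≤ x → |f x| ≤ C
  bdd₂ : ∃ C : ℝ, ∀ x, 0 < x → |deriv (deriv f) x| ≤ C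

end ResettingBM

end

/-!
Write `Y` for the process before reflection (`signedPath`), so that `X⁺ = |Y|`.

*Transition laws.* The path of `Y` is the almost sure limit of a discrete chain which follows the
increments of `√2 W` and is put to `0` at the end of each grid cell in which `N` jumps
(`Inputs.tendsto_gridPath`). For the chain the increments over a cell are independent of the
past, so that the characteristic function of `Y` given the past at time `s` obeys an affine
recursion; in the limit (`Inputs.integral_exp_signedPath`),
`E[exp (i l Y (s + t)) | past] = D exp (i l Y s) + r (1 - D) / (r + l²)`, `D = exp (-(r + l²) t)`.
This determines the transition kernel (`Inputs.charFun_signedKernel`), gives the Markov property of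
`Y` and, as the kernel commutes with `z ↦ -z`, that of `|Y|` (`Inputs.lintegral_mul_resetRBM`). The
symmetrized exponential law has the characteristic function `r / (r + l²)`, which is a fixed point
of this affine map, so that the exponential law of rate `√r` is invariant for `X⁺`
(`Inputs.absKernel_comp_expMeasure`).

*Reversal.* By stationarity the joint law of `(X^R_0, X^R_t)` is the swap of `μ ⊗ₘ κ_t`
(`Inputs.compProd_condDistrib`), `κ_t` being the transition kernel of `X⁺`; this is the reversal
identity for the transition laws. Integrating `f(y) g(x)` against it gives the duality of the
transition operators for `f` and `g` in `L²(μ)`, and the adjointness of the generators is the limit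
of this duality for difference quotients. The Markov property of `X^R` follows from that of `X⁺` on
cylinder sets: the coordinates of the reversed path up to time `s` are values of `X⁺` at times after
`T - s`, and a product of functions of them is replaced, given the past of `X⁺` at time `T - s`, by
a function of `X⁺_{T-s}` alone (`Inputs.map_timeReversal_prod`).

*The generator.* A function in the explicit domain extends to a bounded even function `F` on the
line with a Lipschitz derivative. On paths without a jump before `t` the process is `x + √2 W`, and
Taylor's formula gives `F''(x)`; with probability `1 - exp (-r t)` there is a jump, after which `Y`
is close to `0` in mean square, and this gives `r (F 0 - F x)`. The error after a jump is controlled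
by the second moment of `Y` started at `0`, which is at most `2 t`, while the paths without a jump
already account for `2 t exp (-r t)` of it (`Inputs.setIntegral_sq_signedPath_le`).

*Completeness.* The last jump time is a limit of functions of the inputs off a null set only, so all
of this is carried out on a complete probability space; as the laws of the processes do not change
under completion, this is no restriction.
-/

noncomputable section

namespace ResettingBM

/-! ### The reset path and its grid approximation -/

section

/-- The path `resetPath` with the resettings performed on the grid `s + k h` only: the path starts
at `y` at time `s`, follows the increments of `b` over the grid cells in which `n` does not jump,
and is put to `0` at the end of the other cells. -/
def gridReset (y : ℝ) (b : ℝ≥0 → ℝ) (n : ℝ≥0 → ℕ) (s h : ℝ≥0) : ℕ → ℝ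
  | 0 => y
  | k + 1 =>
    if n (s + (k + 1 : ℕ) * h) - n (s + k * h) = 0 then
      gridReset y b n s h k + (b (s + (k + 1 : ℕ) * h) - b (s + k * h))
    else 0

/-- Unrolling of the recursion: `j` is the index of the last grid point at which the path is put to
`0`, or `0` if there is none. -/
lemma exists_gridReset_eq (y : ℝ) (b : ℝ≥0 → ℝ) {n : ℝ≥0 → ℕ} (hn : Monotone n) (s h : ℝ≥0)
    (k : ℕ) : ∃ j : ℕ, n (s + j * h) = n (s + k * h) ∧
      (∀ i : ℕ, j = i + 1 → n (s + i * h) < n (s + j * h)) ∧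
      gridReset y b n s h k = (if j = 0 then y else 0) + (b (s + k * h) - b (s + j * h)) := by
  induction k with
  | zero => exact ⟨0, rfl, by simp, by simp [gridReset]⟩
  | succ k ih =>
    obtain ⟨j, hj, hj', hy⟩ := ih
    have hle : n (s + k * h) ≤ n (s + (k + 1 : ℕ) * h) := hn (by gcongr; simp)
    by_cases hc : n (s + (k + 1 : ℕ) * h) - n (s + k * h) = 0
    · refine ⟨j, by omega, hj', ?_⟩
      rw [gridReset, if_pos hc, hy]
      ring
    · refine ⟨k + 1, rfl, ?_, ?_⟩
      · intro i hi
        obtain rfl : k = i := by omega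
        omega
      · rw [gridReset, if_neg hc]
        simp

lemma lastJump_eq_of_eq {n : ℝ≥0 → ℕ} {s t : ℝ≥0} (h : n s = n t) :
    lastJump n s = lastJump n t := by
  simp [lastJump, h]

lemma lastJump_of_eq_zero {n : ℝ≥0 → ℕ} (h0 : n 0 = 0) {t : ℝ≥0} (h : n t = 0) :
    lastJump n t = 0 := by
  refine le_antisymm (csInf_le (OrderBot.bddBelow _) ?_) zero_le
  simp [h0, h]

/-- The grid approximation differs from the path by one increment of `b` over an interval no longer
than the mesh: the reset of the last jump is performed at the first grid point after it. -/
lemma exists_gridReset_eq_resetPath (x : ℝ) (b : ℝ≥0 → ℝ) {n : ℝ≥0 → ℕ} (hn : Monotone n)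
    (s h : ℝ≥0) (k : ℕ) :
    ∃ σ : ℝ≥0, dist σ (lastJump n (s + k * h)) ≤ h ∧
      gridReset (resetPath x b n s) b n s h k =
        resetPath x b n (s + k * h) + (b (lastJump n (s + k * h)) - b σ) := by
  obtain ⟨j, hj, hj', hy⟩ := exists_gridReset_eq (resetPath x b n s) b hn s h k
  rcases j with _ | i
  · refine ⟨lastJump n (s + k * h), by simp, ?_⟩
    have hs : n s = n (s + k * h) := by simpa using hj
    rw [hy, resetPath, resetPath, lastJump_eq_of_eq hs, hs]
    simp only [if_true, Nat.cast_zero, zero_mul, add_zero, sub_self]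
    ring
  · have hlt := hj' i rfl
    have h1 : lastJump n (s + k * h) ≤ s + (i + 1 : ℕ) * h := csInf_le (OrderBot.bddBelow _) hj
    have h2 : s + i * h ≤ lastJump n (s + k * h) := by
      refine le_csInf ⟨_, rfl⟩ fun a (ha : n a = _) => ?_
      by_contra! hc
      have := hn hc.le
      omega
    refine ⟨s + (i + 1 : ℕ) * h, ?_, ?_⟩
    · rw [NNReal.dist_eq, abs_of_nonneg (sub_nonneg.2 (NNReal.coe_le_coe.2 h1))]
      have h3 : (s : ℝ) + i * h ≤ lastJump n (s + k * h) := by exact_mod_cast h2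
      push_cast
      linarith
    · have hne : n (s + k * h) ≠ 0 := by omega
      rw [hy, if_neg (by omega), resetPath, if_neg hne]
      ring

/-- As the mesh tends to `0`, the grid approximation on `[s, s + t]` tends to the path. -/
lemma tendsto_gridReset (x : ℝ) {b : ℝ≥0 → ℝ} (hb : Continuous b) {n : ℝ≥0 → ℕ} (hn : Monotone n)
    (s t : ℝ≥0) :
    Tendsto (fun m : ℕ => gridReset (resetPath x b n s) b n s (t / (m + 1 : ℕ)) (m + 1)) atTop
      (𝓝 (resetPath x b n (s + t))) := by
  have hm : ∀ m : ℕ, s + (m + 1 : ℕ) * (t / (m + 1 : ℕ)) = s + t := fun m => by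
    rw [mul_div_cancel₀]
    positivity
  choose σ hσ hg using fun m : ℕ =>
    exists_gridReset_eq_resetPath x b hn s (t / (m + 1 : ℕ)) (m + 1)
  simp only [hm] at hσ hg
  have hlim : Tendsto σ atTop (𝓝 (lastJump n (s + t))) := by
    refine tendsto_iff_dist_tendsto_zero.2 (squeeze_zero (fun _ => dist_nonneg) hσ ?_)
    have := (tendsto_const_div_atTop_nhds_zero_nat (t : ℝ)).comp (tendsto_add_atTop_nat 1)
    simpa [Function.comp_def] using this
  have h3 := ((hb.tendsto _).comp hlim).const_sub (b (lastJump n (s + t)))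
  have h4 := h3.const_add (resetPath x b n (s + t))
  simp only [sub_self, add_zero] at h4
  exact h4.congr fun m => (hg m).symm

end

/-! ### The past of the inputs and their increments -/

section

variable {Ω : Type*} [mΩ : MeasurableSpace Ω] {P : Measure Ω}

/-- If `a, b, c, d` are such that `a ⟂ b`, `c ⟂ d` and `(a, b) ⟂ (c, d)`, then they can be
regrouped: `(a, c) ⟂ (b, d)`. -/
lemma indepFun_prodMk_prodMk_of_indepFun [IsProbabilityMeasure P] {α β γ δ : Type*}
    [MeasurableSpace α] [MeasurableSpace β] [MeasurableSpace γ] [MeasurableSpace δ]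
    {a : Ω → α} {b : Ω → β} {c : Ω → γ} {d : Ω → δ}
    (ha : Measurable a) (hb : Measurable b) (hc : Measurable c) (hd : Measurable d)
    (hab : IndepFun a b P) (hcd : IndepFun c d P)
    (h : IndepFun (fun ω => (a ω, b ω)) (fun ω => (c ω, d ω)) P) :
    IndepFun (fun ω => (a ω, c ω)) (fun ω => (b ω, d ω)) P := by
  have hac : IndepFun a c P := h.comp measurable_fst measurable_fst
  have hbd : IndepFun b d P := h.comp measurable_snd measurable_snd
  rw [IndepFun_iff_Indep]
  refine IndepSets.indep (ha.prodMk hc).comap_le (hb.prodMk hd).comap_le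
    (isPiSystem_prod.comap _) (isPiSystem_prod.comap _)
    (by rw [← generateFrom_prod, MeasurableSpace.comap_generateFrom]; rfl)
    (by rw [← generateFrom_prod, MeasurableSpace.comap_generateFrom]; rfl) ?_
  rw [IndepSets_iff]
  rintro _ _ ⟨_, ⟨A, hA, C, hC, rfl⟩, rfl⟩ ⟨_, ⟨B, hB, D, hD, rfl⟩, rfl⟩
  have e1 : (fun ω => (a ω, c ω)) ⁻¹' A ×ˢ C = a ⁻¹' A ∩ c ⁻¹' C := rfl
  have e2 : (fun ω => (b ω, d ω)) ⁻¹' B ×ˢ D = b ⁻¹' B ∩ d ⁻¹' D := rfl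
  have e3 : (fun ω => (a ω, b ω)) ⁻¹' A ×ˢ B = a ⁻¹' A ∩ b ⁻¹' B := rfl
  have e4 : (fun ω => (c ω, d ω)) ⁻¹' C ×ˢ D = c ⁻¹' C ∩ d ⁻¹' D := rfl
  have h1 := h.measure_inter_preimage_eq_mul _ _ (hA.prod hB) (hC.prod hD)
  rw [e3, e4, hab.measure_inter_preimage_eq_mul _ _ hA hB,
    hcd.measure_inter_preimage_eq_mul _ _ hC hD] at h1
  rw [e1, e2, hac.measure_inter_preimage_eq_mul _ _ hA hC,
    hbd.measure_inter_preimage_eq_mul _ _ hB hD, inter_inter_inter_comm, h1]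
  ring

/-- A finite set of times before `u` is visited by a nondecreasing sequence which starts at `0` and
ends at `u`. -/
lemma exists_monotone_seq (J : Finset ℝ≥0) (u : ℝ≥0) (hJ : ∀ j ∈ J, j ≤ u) :
    ∃ (K : ℕ) (τ : ℕ → ℝ≥0), Monotone τ ∧ τ 0 = 0 ∧ (∀ j ∈ J, ∃ i ≤ K, τ i = j) ∧
      ∀ i, K ≤ i → τ i = u := by
  induction J using Finset.induction_on_max generalizing u with
  | empty =>
    refine ⟨1, fun i => if i = 0 then 0 else u, ?_, by simp, by simp, ?_⟩
    · intro i j hij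
      dsimp only
      split_ifs <;> first | omega | simp
    · intro i hi
      simp [show i ≠ 0 by omega]
  | insert a J ha ih =>
    obtain ⟨K, τ, hτ, h0, hc, hu⟩ := ih a fun j hj => (ha j hj).le
    have hau : a ≤ u := hJ a (by simp)
    have hle : ∀ i, τ i ≤ a := fun i => (hτ (le_max_left i K)).trans (hu _ (le_max_right i K)).le
    refine ⟨K + 1, fun i => if i ≤ K then τ i else u, ?_, by simpa using h0, ?_, ?_⟩
    · intro i j hij
      dsimp only
      split_ifs
      · exact hτ hij
      · exact (hle i).trans hau
      · omega
      · exact le_rfl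
    · intro j hj
      rcases Finset.mem_insert.1 hj with rfl | hj
      · exact ⟨K, by omega, by simpa using hu K le_rfl⟩
      · obtain ⟨i, hi, rfl⟩ := hc j hj
        exact ⟨i, by omega, by simp [hi]⟩
    · intro i hi
      simp [show ¬ i ≤ K by omega]

/-- The increments of a Poisson process are independent of its past. -/
lemma IsPoissonProcess.indepFun_past [IsProbabilityMeasure P] {N : ℝ≥0 → Ω → ℕ} {r : ℝ≥0}
    (hN : IsPoissonProcess N r P) (hm : ∀ t, Measurable (N t)) {u v : ℝ≥0} (huv : u ≤ v) :
    IndepFun (fun ω (w : Iic u) => N w ω) (fun ω => N v ω - N u ω) P := by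
  refine IndepFun.process_indepFun (X := fun (w : Iic u) ω => N w ω) (fun w => hm _)
    ((hm v).sub (hm u)) fun I => ?_
  obtain ⟨K, τ, hτ, h0, hc, hu⟩ := exists_monotone_seq (I.image (↑)) u (by
    intro j hj
    obtain ⟨w, -, rfl⟩ := Finset.mem_image.1 hj
    exact w.2)
  have hle : ∀ i, τ i ≤ u := fun i => (hτ (le_max_left i K)).trans (hu _ (le_max_right i K)).le
  let σ : ℕ → ℝ≥0 := fun i => if i ≤ K then τ i else v
  have hσ : Monotone σ := by
    intro i j hij
    dsimp only [σ]
    split_ifs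
    · exact hτ hij
    · exact (hle i).trans huv
    · omega
    · exact le_rfl
  have hσi : ∀ i, i ≤ K → σ i = τ i := fun i hi => if_pos hi
  have key := (hN.indep.nat hσ).indepFun_finset (Finset.range K) {K} (by simp)
    (fun i => (hm _).sub (hm _))
  choose idx hidx hτidx using fun w : I => hc w.1 (Finset.mem_image_of_mem _ w.2)
  -- each `N w` is the sum of the first increments along the sequence
  let φ : (Finset.range K → ℕ) → (I → ℕ) := fun x w => ∑ j, if j.1 < idx w then x j else 0
  have hφ : Measurable φ := by
    refine measurable_pi_lambda _ fun w => Finset.measurable_fun_sum _ fun j _ => ?_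
    by_cases hj : j.1 < idx w
    · simpa [hj] using measurable_pi_apply j
    · simp [hj]
  refine (key.comp hφ (measurable_pi_apply (⟨K, by simp⟩ : ({K} : Finset ℕ)))).congr ?_ ?_
  · filter_upwards [hN.zero, hN.mono] with ω hω0 hωm
    ext w
    have hmono : Monotone fun i => N (σ i) ω := hωm.comp hσ
    have hs := Finset.sum_range_tsub hmono (idx w)
    have h00 : σ 0 = 0 := (hσi 0 (Nat.zero_le _)).trans h0
    rw [h00, hω0, tsub_zero, hσi _ (hidx w), hτidx w] at hs
    rw [← hs]
    simp only [φ, Function.comp_apply]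
    rw [Finset.sum_coe_sort (Finset.range K)
      (fun j => if j < idx w then N (σ (j + 1)) ω - N (σ j) ω else 0), ← Finset.sum_filter]
    congr 1
    ext j
    have := hidx w
    simp only [Finset.mem_filter, Finset.mem_range]
    omega
  · refine Eventually.of_forall fun ω => ?_
    simp [σ, hu K le_rfl]

/-- The random inputs of the resetting process: a starting point `ξ`, a Brownian motion `W` and a
Poisson process `N` of intensity `r`, mutually independent. -/
structure Inputs (P : Measure Ω) (r : ℝ≥0) (ξ : Ω → ℝ) (W : ℝ≥0 → Ω → ℝ) (N : ℝ≥0 → Ω → ℕ) :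
    Prop where
  measurable_start : Measurable ξ
  measurable_brownian : ∀ t, Measurable (W t)
  measurable_poisson : ∀ t, Measurable (N t)
  brownian : IsBrownianReal W P
  poisson : IsPoissonProcess N r P
  indep : IndepFun (fun ω t => W t ω) (fun ω t => N t ω) P
  indep_start : IndepFun ξ (fun ω => ((fun t => W t ω), (fun t => N t ω))) P

/-- The inputs up to time `u`. -/
def pastInputs (ξ : Ω → ℝ) (W : ℝ≥0 → Ω → ℝ) (N : ℝ≥0 → Ω → ℕ) (u : ℝ≥0) (ω : Ω) :
    ℝ × (Iic u → ℝ) × (Iic u → ℕ) :=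
  (ξ ω, (fun w : Iic u => W w ω), (fun w : Iic u => N w ω))

/-- The σ-algebra of the past: the events which are, up to a null set, determined by the inputs up
to time `u`. The last jump time is only an almost sure limit of functions of these inputs, so that
the null sets are needed. -/
@[reducible]
def past (P : Measure Ω) (ξ : Ω → ℝ) (W : ℝ≥0 → Ω → ℝ) (N : ℝ≥0 → Ω → ℕ) (u : ℝ≥0) :
    MeasurableSpace Ω :=
  eventuallyMeasurableSpace (MeasurableSpace.comap (pastInputs ξ W N u) inferInstance) (ae P)

variable {r : ℝ≥0} {ξ : Ω → ℝ} {W : ℝ≥0 → Ω → ℝ} {N : ℝ≥0 → Ω → ℕ}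

lemma measurable_past_of_ae_eq {β : Type*} [MeasurableSpace β] {u : ℝ≥0} {f g : Ω → β}
    (hf : Measurable[past P ξ W N u] f) (h : f =ᵐ[P] g) : Measurable[past P ξ W N u] g :=
  EventuallyMeasurable.congr hf h.symm

lemma measurable_past_pastInputs (u : ℝ≥0) :
    Measurable[past P ξ W N u] (pastInputs ξ W N u) :=
  (comap_measurable _).mono le_eventuallyMeasurableSpace le_rfl

lemma measurable_past_brownian {u w : ℝ≥0} (h : w ≤ u) : Measurable[past P ξ W N u] (W w) :=
  (measurable_pi_apply (⟨w, h⟩ : Iic u)).comp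
    (measurable_fst.comp (measurable_snd.comp (measurable_past_pastInputs u)))

lemma measurable_past_poisson {u w : ℝ≥0} (h : w ≤ u) : Measurable[past P ξ W N u] (N w) :=
  (measurable_pi_apply (⟨w, h⟩ : Iic u)).comp
    (measurable_snd.comp (measurable_snd.comp (measurable_past_pastInputs u)))

lemma past_mono {u v : ℝ≥0} (h : u ≤ v) : past P ξ W N u ≤ past P ξ W N v := by
  have hle : MeasurableSpace.comap (pastInputs ξ W N u) inferInstance ≤
      MeasurableSpace.comap (pastInputs ξ W N v) inferInstance := by
    let π : ℝ × (Iic v → ℝ) × (Iic v → ℕ) → ℝ × (Iic u → ℝ) × (Iic u → ℕ) := fun p =>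
      (p.1, (fun w => p.2.1 ⟨w, w.2.trans h⟩), (fun w => p.2.2 ⟨w, w.2.trans h⟩))
    have hπ : Measurable π := by fun_prop
    have : pastInputs ξ W N u = π ∘ pastInputs ξ W N v := rfl
    rw [this, ← MeasurableSpace.comap_comp]
    exact MeasurableSpace.comap_mono hπ.comap_le
  rintro s ⟨t, ht, hst⟩
  exact ⟨t, hle t ht, hst⟩

lemma Inputs.measurable_pastInputs (h : Inputs P r ξ W N) (u : ℝ≥0) :
    Measurable (pastInputs ξ W N u) :=
  h.measurable_start.prodMk <|
    (measurable_pi_lambda _ fun w : Iic u => h.measurable_brownian w).prodMk <|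
    measurable_pi_lambda _ fun w : Iic u => h.measurable_poisson w

lemma Inputs.past_le [P.IsComplete] (h : Inputs P r ξ W N) (u : ℝ≥0) :
    past P ξ W N u ≤ mΩ := by
  rintro s ⟨t, ht, hst⟩
  have ht' := (h.measurable_pastInputs u).comap_le t ht
  exact (NullMeasurableSet.congr ht'.nullMeasurableSet hst.symm).measurable_of_complete

/-- The increment of the noises over `[u, v]`. -/
def increment (W : ℝ≥0 → Ω → ℝ) (N : ℝ≥0 → Ω → ℕ) (u v : ℝ≥0) (ω : Ω) : ℝ × ℕ :=
  (W v ω - W u ω, N v ω - N u ω)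

lemma Inputs.measurable_increment (h : Inputs P r ξ W N) (u v : ℝ≥0) :
    Measurable (increment W N u v) :=
  ((h.measurable_brownian v).sub (h.measurable_brownian u)).prodMk
    ((h.measurable_poisson v).sub (h.measurable_poisson u))

lemma Inputs.indepFun_increment (h : Inputs P r ξ W N) (u v : ℝ≥0) :
    IndepFun (fun ω => W v ω - W u ω) (fun ω => N v ω - N u ω) P :=
  h.indep.comp (φ := fun w : ℝ≥0 → ℝ => w v - w u) (ψ := fun n : ℝ≥0 → ℕ => n v - n u)
    (by fun_prop) (by fun_prop)

lemma Inputs.indepFun_past [IsProbabilityMeasure P] (h : Inputs P r ξ W N) {u v : ℝ≥0}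
    (huv : u ≤ v) : IndepFun (pastInputs ξ W N u) (increment W N u v) P := by
  have hWm : Measurable fun ω (w : Iic u) => W w ω :=
    measurable_pi_lambda _ fun w => h.measurable_brownian w
  have hNm : Measurable fun ω (w : Iic u) => N w ω :=
    measurable_pi_lambda _ fun w => h.measurable_poisson w
  have hWi := (h.measurable_brownian v).sub (h.measurable_brownian u)
  have hNi := (h.measurable_poisson v).sub (h.measurable_poisson u)
  have hW : IndepFun (fun ω (w : Iic u) => W w ω) (fun ω => W v ω - W u ω) P := by
    refine ((h.brownian.indepFun_shift u).symm.comp measurable_id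
      (measurable_pi_apply (v - u))).congr .rfl (Eventually.of_forall fun ω => ?_)
    simp [add_tsub_cancel_of_le huv]
  have h1 : IndepFun (fun ω => ((fun w : Iic u => W w ω), (fun w : Iic u => N w ω)))
      (increment W N u v) P := by
    refine indepFun_prodMk_prodMk_of_indepFun hWm hWi hNm hNi hW
      (h.poisson.indepFun_past h.measurable_poisson huv) ?_
    exact h.indep.comp (φ := fun x : ℝ≥0 → ℝ => ((fun w : Iic u => x w), x v - x u))
      (ψ := fun x : ℝ≥0 → ℕ => ((fun w : Iic u => x w), x v - x u)) (by fun_prop) (by fun_prop)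
  have h2 : IndepFun (fun ω => (ξ ω, ())) (fun ω => (((fun w : Iic u => W w ω),
      (fun w : Iic u => N w ω)), increment W N u v ω)) P := by
    exact h.indep_start.comp (φ := fun x => (x, ()))
      (ψ := fun x : (ℝ≥0 → ℝ) × (ℝ≥0 → ℕ) => (((fun w : Iic u => x.1 w),
        (fun w : Iic u => x.2 w)), (x.1 v - x.1 u, x.2 v - x.2 u))) (by fun_prop) (by fun_prop)
  have h3 := indepFun_prodMk_prodMk_of_indepFun h.measurable_start (measurable_const (a := ()))
    (hWm.prodMk hNm) (h.measurable_increment u v) (indepFun_const_right _ ()) h1 h2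
  exact h3.comp measurable_id measurable_snd

/-- The increments over `[u, v]` are independent of the past at time `u`. -/
lemma Inputs.indep_past [IsProbabilityMeasure P] (h : Inputs P r ξ W N) {u v : ℝ≥0}
    (huv : u ≤ v) {β : Type*} [MeasurableSpace β] {f : Ω → β}
    (hf : Measurable[past P ξ W N u] f) : IndepFun f (increment W N u v) P := by
  rw [IndepFun_iff]
  rintro _ _ ⟨A, hA, rfl⟩ ⟨B, hB, rfl⟩
  obtain ⟨_, ⟨C, hC, rfl⟩, hAC⟩ := hf hA
  rw [measure_congr hAC, measure_congr (hAC.inter (ae_eq_refl (increment W N u v ⁻¹' B)))]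
  exact (h.indepFun_past huv).measure_inter_preimage_eq_mul _ _ hC hB

/-- The process before reflection. -/
def signedPath (ξ : Ω → ℝ) (W : ℝ≥0 → Ω → ℝ) (N : ℝ≥0 → Ω → ℕ) (t : ℝ≥0) (ω : Ω) : ℝ :=
  resetPath (ξ ω) (fun s => √2 * W s ω) (fun s => N s ω) t

/-- The approximation of `signedPath` over `[s, s + k h]` with resettings on the grid. -/
def gridPath (Y : Ω → ℝ) (W : ℝ≥0 → Ω → ℝ) (N : ℝ≥0 → Ω → ℕ) (s h : ℝ≥0) (k : ℕ)
    (ω : Ω) : ℝ :=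
  gridReset (Y ω) (fun s => √2 * W s ω) (fun s => N s ω) s h k

lemma gridPath_succ {Ω : Type*} (Y : Ω → ℝ) (W : ℝ≥0 → Ω → ℝ) (N : ℝ≥0 → Ω → ℕ) (s h : ℝ≥0) (k : ℕ)
    (ω : Ω) : gridPath Y W N s h (k + 1) ω =
      if (increment W N (s + k * h) (s + (k + 1 : ℕ) * h) ω).2 = 0 then
        gridPath Y W N s h k ω +
          √2 * (increment W N (s + k * h) (s + (k + 1 : ℕ) * h) ω).1
      else 0 := by
  simp only [gridPath, gridReset, increment, mul_sub]

lemma measurable_gridPath_succ {Ω : Type*} {W : ℝ≥0 → Ω → ℝ} {N : ℝ≥0 → Ω → ℕ}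
    {m : MeasurableSpace Ω} {Y : Ω → ℝ} {s h : ℝ≥0} {k : ℕ}
    (h1 : Measurable[m] (increment W N (s + k * h) (s + (k + 1 : ℕ) * h)))
    (h2 : Measurable[m] (gridPath Y W N s h k)) :
    Measurable[m] (gridPath Y W N s h (k + 1)) := by
  rw [funext (gridPath_succ Y W N s h k)]
  exact Measurable.ite (h1.snd (measurableSet_singleton 0)) (h2.add (h1.fst.const_mul _))
    measurable_const

lemma measurable_past_increment {u v : ℝ≥0} (h : u ≤ v) :
    Measurable[past P ξ W N v] (increment W N u v) :=
  ((measurable_past_brownian le_rfl).sub (measurable_past_brownian h)).prodMk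
    ((measurable_past_poisson le_rfl).sub (measurable_past_poisson h))

lemma measurable_past_gridPath {Y : Ω → ℝ} {s : ℝ≥0} (hY : Measurable[past P ξ W N s] Y)
    (h : ℝ≥0) (k : ℕ) : Measurable[past P ξ W N (s + k * h)] (gridPath Y W N s h k) := by
  induction k with
  | zero =>
    rw [Nat.cast_zero, zero_mul, add_zero]
    exact hY
  | succ k ih =>
    have hle : s + k * h ≤ s + (k + 1 : ℕ) * h := by gcongr; simp
    exact measurable_gridPath_succ (measurable_past_increment hle)
      (ih.mono (past_mono hle) le_rfl)

lemma Inputs.tendsto_gridPath (h : Inputs P r ξ W N) (s t : ℝ≥0) :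
    ∀ᵐ ω ∂P, Tendsto (fun m : ℕ =>
      gridPath (signedPath ξ W N s) W N s (t / (m + 1 : ℕ)) (m + 1) ω) atTop
      (𝓝 (signedPath ξ W N (s + t) ω)) := by
  filter_upwards [h.brownian.cont, h.poisson.mono] with ω h1 h2
  exact tendsto_gridReset (ξ ω) (h1.const_mul _) h2 s t

lemma signedPath_zero (h : Inputs P r ξ W N) : signedPath ξ W N 0 =ᵐ[P] ξ := by
  filter_upwards [h.poisson.zero] with ω h3
  simp [signedPath, resetPath, h3, lastJump_of_eq_zero]

/-- The process is adapted to the past. -/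
lemma Inputs.measurable_past_signedPath (h : Inputs P r ξ W N) {t u : ℝ≥0} (htu : t ≤ u) :
    Measurable[past P ξ W N u] (signedPath ξ W N t) := by
  have h0 : Measurable[past P ξ W N 0] (signedPath ξ W N 0) :=
    measurable_past_of_ae_eq (measurable_fst.comp (measurable_past_pastInputs 0))
      (signedPath_zero h).symm
  refine Measurable.mono ?_ (past_mono htu) le_rfl
  have hm : ∀ m : ℕ, Measurable[past P ξ W N t]
      (gridPath (signedPath ξ W N 0) W N 0 (t / (m + 1 : ℕ)) (m + 1)) := fun m => by
    have := measurable_past_gridPath h0 (t / (m + 1 : ℕ)) (m + 1)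
    rwa [zero_add, mul_div_cancel₀ t (by positivity)] at this
  refine measurable_past_of_ae_eq (Measurable.limsup (mδ := past P ξ W N t) hm) ?_
  filter_upwards [h.tendsto_gridPath 0 t] with ω hω
  simpa using hω.limsup_eq

end

/-! ### Characteristic functions of the process before reflection -/

section

variable {Ω : Type*} [mΩ : MeasurableSpace Ω] {P : Measure Ω}
  {r : ℝ≥0} {ξ : Ω → ℝ} {W : ℝ≥0 → Ω → ℝ} {N : ℝ≥0 → Ω → ℕ}

/-- The factor `exp (-(r + l²) t)`: the value at `l` of the characteristic function of `B t`,
multiplied by the probability that `N` does not jump before `t`. -/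
def decay (r : ℝ≥0) (l : ℝ) (t : ℝ≥0) : ℝ := Real.exp (-((r + l ^ 2) * t))

lemma decay_nonneg (r : ℝ≥0) (l : ℝ) (t : ℝ≥0) : 0 ≤ decay r l t := (Real.exp_pos _).le

lemma decay_pow (r : ℝ≥0) (l : ℝ) (t : ℝ≥0) (n : ℕ) : decay r l t ^ n = decay r l (n * t) := by
  rw [decay, decay, ← Real.exp_nat_mul]
  congr 1
  push_cast
  ring

lemma tendsto_one_sub_exp_div (c : ℝ) {h : ℕ → ℝ} (h0 : ∀ m, h m ≠ 0)
    (hh : Tendsto h atTop (𝓝 0)) :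
    Tendsto (fun m => (1 - Real.exp (-(c * h m))) / h m) atTop (𝓝 c) := by
  have hd : HasDerivAt (fun x => -Real.exp (-(c * x))) c 0 := by
    have := ((hasDerivAt_id (0 : ℝ)).const_mul c).fun_neg.exp.fun_neg
    simpa using this
  have := hd.tendsto_slope_zero.comp
    (tendsto_nhdsWithin_iff.2 ⟨hh, Eventually.of_forall fun m => h0 m⟩)
  refine this.congr fun m => ?_
  simp only [Function.comp_apply, zero_add, mul_zero, neg_zero, Real.exp_zero, smul_eq_mul]
  ring

/-- The sums of the contributions of the resettings on the grids converge. -/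
lemma tendsto_reset_sum (hr : 0 < r) (l : ℝ) (t : ℝ≥0) :
    Tendsto (fun m : ℕ => (1 - decay r 0 (t / (m + 1 : ℕ))) *
      ∑ j ∈ Finset.range (m + 1), decay r l (t / (m + 1 : ℕ)) ^ j) atTop
      (𝓝 (r / (r + l ^ 2) * (1 - decay r l t))) := by
  have hr' : (0 : ℝ) < r := hr
  have hz : (0 : ℝ) < r + l ^ 2 := by positivity
  rcases eq_or_ne t 0 with rfl | ht
  · simp [decay]
  have ht' : (0 : ℝ) < t := NNReal.coe_pos.2 (pos_iff_ne_zero.2 ht)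
  have h0 : ∀ m : ℕ, (t : ℝ) / (m + 1 : ℕ) ≠ 0 := fun m => by positivity
  have hh : Tendsto (fun m : ℕ => (t : ℝ) / (m + 1 : ℕ)) atTop (𝓝 0) :=
    (tendsto_const_div_atTop_nhds_zero_nat (t : ℝ)).comp (tendsto_add_atTop_nat 1)
  have h1 := (tendsto_one_sub_exp_div r h0 hh).div
    (tendsto_one_sub_exp_div (r + l ^ 2) h0 hh) hz.ne'
  refine (h1.mul_const (1 - decay r l t)).congr fun m => ?_
  have hpow : decay r l t = decay r l (t / (m + 1 : ℕ)) ^ (m + 1) := by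
    rw [decay_pow, mul_div_cancel₀ t (by positivity)]
  have hne : decay r l (t / (m + 1 : ℕ)) ≠ 1 := by
    rw [decay, Ne, Real.exp_eq_one_iff, neg_eq_zero, NNReal.coe_div, NNReal.coe_natCast]
    exact mul_ne_zero hz.ne' (h0 m)
  rw [geom_sum_eq hne, ← hpow]
  have e1 : Real.exp (-((r + l ^ 2) * (t / (m + 1 : ℕ)))) = decay r l (t / (m + 1 : ℕ)) := by
    simp [decay]
  have e2 : Real.exp (-(r * (t / (m + 1 : ℕ)))) = decay r 0 (t / (m + 1 : ℕ)) := by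
    simp [decay]
  simp only [Pi.div_apply]
  rw [e1, e2, div_div_div_cancel_right₀ (h0 m)]
  have hne1 := sub_ne_zero.2 hne
  have hne2 := sub_ne_zero.2 hne.symm
  field_simp
  ring

/-- The probability of having no jump in `[u, v]`. -/
lemma Inputs.measureReal_no_jump (h : Inputs P r ξ W N) {u v : ℝ≥0} (huv : u ≤ v) :
    P.real {ω | N v ω - N u ω = 0} = decay r 0 (v - u) := by
  rw [(h.poisson.law u v huv).measureReal_eq (p := fun n => n = 0) (measurableSet_singleton 0)]
  simp [decay, poissonMeasure_real_singleton]

lemma Inputs.integral_exp_brownian (h : Inputs P r ξ W N) {u v : ℝ≥0} (huv : u ≤ v) (l : ℝ) :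
    ∫ ω, Complex.exp (l * (√2 * (W v ω - W u ω) : ℝ) * Complex.I) ∂P =
      (Real.exp (-(l ^ 2 * (v - u : ℝ≥0))) : ℂ) := by
  have h1 := (h.brownian.hasLaw_sub v u).integral_comp
    (f := fun x : ℝ => Complex.exp (l * (√2 * x : ℝ) * Complex.I)) (by fun_prop)
  have hd : nndist v.1 u.1 = v - u := by
    ext
    rw [coe_nndist, NNReal.coe_sub huv]
    exact abs_of_nonneg (sub_nonneg.2 (NNReal.coe_le_coe.2 huv))
  have h2 := charFun_gaussianReal (μ := 0) (v := v - u) (l * √2)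
  rw [charFun_apply_real] at h2
  rw [hd] at h1
  simp only [Function.comp_def, Pi.sub_apply] at h1
  rw [h1]
  convert h2 using 2
  · ext x
    push_cast
    ring_nf
  · have : ((√2 : ℝ) : ℂ) ^ 2 = 2 := by
      rw [← Complex.ofReal_pow, Real.sq_sqrt (by norm_num)]
      simp
    push_cast
    congr 1
    rw [mul_pow, this]
    ring

/-- The contribution to the characteristic function of a grid cell without a jump. -/
lemma Inputs.integral_exp_increment (h : Inputs P r ξ W N) {u v : ℝ≥0}
    (huv : u ≤ v) (l : ℝ) :
    ∫ ω, (if (increment W N u v ω).2 = 0 then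
      Complex.exp (l * (√2 * (increment W N u v ω).1 : ℝ) * Complex.I) else 0) ∂P =
      (decay r l (v - u) : ℂ) := by
  have h1 := (h.indepFun_increment u v).integral_fun_comp_mul_comp
    ((h.measurable_brownian v).sub (h.measurable_brownian u)).aemeasurable
    ((h.measurable_poisson v).sub (h.measurable_poisson u)).aemeasurable
    (f := fun x : ℝ => Complex.exp (l * (√2 * x : ℝ) * Complex.I))
    (g := ({0} : Set ℕ).indicator fun _ => (1 : ℂ)) (by fun_prop)
    (Measurable.of_discrete.aestronglyMeasurable)
  have h2 : ∫ ω, ({0} : Set ℕ).indicator (fun _ => (1 : ℂ)) (N v ω - N u ω) ∂P =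
      (decay r 0 (v - u) : ℂ) := by
    have hm : MeasurableSet {ω | N v ω - N u ω = 0} :=
      ((h.measurable_poisson v).sub (h.measurable_poisson u)) (measurableSet_singleton 0)
    rw [← h.measureReal_no_jump huv, ← integral_indicator_one hm, ← integral_complex_ofReal]
    congr 1
    ext ω
    by_cases hω : N v ω - N u ω = 0 <;> simp [indicator, hω]
  rw [h.integral_exp_brownian huv l, h2] at h1
  rw [← integral_congr_ae (f := _) (Eventually.of_forall fun ω => ?_), h1]
  · rw [← Complex.ofReal_mul, decay, decay, ← Real.exp_add]
    congr 2
    ring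
  · by_cases hω : N v ω - N u ω = 0 <;> simp [increment, indicator, hω]

/-- One step of the grid chain, on the level of characteristic functions. -/
lemma Inputs.integral_gridPath_succ [IsProbabilityMeasure P] [P.IsComplete]
    (hin : Inputs P r ξ W N) {Y : Ω → ℝ} {s : ℝ≥0} (hY : Measurable[past P ξ W N s] Y)
    {G : Ω → ℂ} (hG : Measurable[past P ξ W N s] G) {C : ℝ} (hC : ∀ ω, ‖G ω‖ ≤ C)
    (l : ℝ) (h : ℝ≥0) (k : ℕ) :
    ∫ ω, G ω * Complex.exp (l * gridPath Y W N s h (k + 1) ω * Complex.I) ∂P =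
      decay r l h * ∫ ω, G ω * Complex.exp (l * gridPath Y W N s h k ω * Complex.I) ∂P +
        (1 - decay r 0 h) * ∫ ω, G ω ∂P := by
  set u := s + k * h with hu
  set v := s + (k + 1 : ℕ) * h with hv
  have huv : u ≤ v := by rw [hu, hv]; gcongr; simp
  have hvu : v - u = h := by
    rw [hu, hv]
    push_cast
    rw [add_mul, ← add_assoc, add_tsub_cancel_left, one_mul]
  have hsu : s ≤ u := le_self_add
  have hGu : Measurable[past P ξ W N u] G := hG.mono (past_mono hsu) le_rfl
  have hyu := measurable_past_gridPath hY h k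
  rw [← hu] at hyu
  have hEu : Measurable[past P ξ W N u]
      fun ω => G ω * Complex.exp (l * gridPath Y W N s h k ω * Complex.I) := by
    refine hGu.mul ?_
    exact (by fun_prop : Measurable fun x : ℝ => Complex.exp (l * x * Complex.I)).comp hyu
  have hle := hin.past_le u
  have hGm : Measurable G := hGu.mono hle le_rfl
  have hEm := hEu.mono hle le_rfl
  have hinc := hin.measurable_increment u v
  let A : ℝ × ℕ → ℂ := fun p =>
    if p.2 = 0 then Complex.exp (l * (√2 * p.1 : ℝ) * Complex.I) else 0
  let D : ℝ × ℕ → ℂ := fun p => if p.2 = 0 then 0 else 1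
  have hs0 : MeasurableSet {p : ℝ × ℕ | p.2 = 0} := measurable_snd (measurableSet_singleton 0)
  have hA : Measurable A := Measurable.ite hs0 (by fun_prop) measurable_const
  have hD : Measurable D := Measurable.ite hs0 measurable_const measurable_const
  have hA1 : ∀ p, ‖A p‖ ≤ 1 := fun p => by
    dsimp only [A]
    split_ifs
    · rw [← Complex.ofReal_mul, Complex.norm_exp_ofReal_mul_I]
    · simp
  have hD1 : ∀ p, ‖D p‖ ≤ 1 := fun p => by
    dsimp only [D]
    split_ifs <;> simp
  have hE1 : ∀ ω, ‖G ω * Complex.exp (l * gridPath Y W N s h k ω * Complex.I)‖ ≤ C :=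
    fun ω => by
      rw [norm_mul, ← Complex.ofReal_mul, Complex.norm_exp_ofReal_mul_I, mul_one]
      exact hC ω
  have i1 := (hin.indep_past huv hEu).integral_fun_comp_mul_comp (f := id) (g := A)
    hEm.aemeasurable hinc.aemeasurable (by fun_prop) hA.aestronglyMeasurable
  have i2 := (hin.indep_past huv hGu).integral_fun_comp_mul_comp (f := id) (g := D)
    hGm.aemeasurable hinc.aemeasurable (by fun_prop) hD.aestronglyMeasurable
  have iA : ∫ ω, A (increment W N u v ω) ∂P = (decay r l h : ℂ) := by
    rw [← hvu]
    exact hin.integral_exp_increment huv l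
  have iD : ∫ ω, D (increment W N u v ω) ∂P = (1 - decay r 0 h : ℂ) := by
    have hm : MeasurableSet {ω | N v ω - N u ω = 0} :=
      ((hin.measurable_poisson v).sub (hin.measurable_poisson u)) (measurableSet_singleton 0)
    have hre : P.real {ω | N v ω - N u ω = 0}ᶜ = 1 - decay r 0 h := by
      rw [probReal_compl_eq_one_sub hm, hin.measureReal_no_jump huv, hvu]
    rw [← Complex.ofReal_one, ← Complex.ofReal_sub, ← hre, ← integral_indicator_one hm.compl,
      ← integral_complex_ofReal]
    congr 1
    ext ω
    by_cases hω : N v ω - N u ω = 0 <;> simp [D, increment, indicator, hω]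
  rw [iA] at i1
  rw [iD] at i2
  simp only [id_eq] at i1 i2
  have hsplit : ∀ ω, G ω * Complex.exp (l * gridPath Y W N s h (k + 1) ω * Complex.I) =
      G ω * Complex.exp (l * gridPath Y W N s h k ω * Complex.I) * A (increment W N u v ω) +
        G ω * D (increment W N u v ω) := fun ω => by
    rw [gridPath_succ, ← hu, ← hv]
    by_cases hω : (increment W N u v ω).2 = 0
    · simp only [A, D, hω, if_true, mul_zero, add_zero, mul_assoc, ← Complex.exp_add,
        Complex.ofReal_add, mul_add, add_mul]
    · simp [A, D, hω]
  simp_rw [hsplit]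
  rw [integral_add, i1, i2]
  · ring
  · refine Integrable.of_bound (hEm.mul (hA.comp hinc)).aestronglyMeasurable (C * 1) ?_
    refine Eventually.of_forall fun ω => ?_
    rw [norm_mul]
    exact mul_le_mul (hE1 ω) (hA1 _) (norm_nonneg _) ((norm_nonneg _).trans (hC ω))
  · refine Integrable.of_bound (hGm.mul (hD.comp hinc)).aestronglyMeasurable (C * 1) ?_
    refine Eventually.of_forall fun ω => ?_
    rw [norm_mul]
    exact mul_le_mul (hC ω) (hD1 _) (norm_nonneg _) ((norm_nonneg _).trans (hC ω))

/-- The recursion of `Inputs.integral_gridPath_succ` is affine, and is solved by a geometric sum. -/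
lemma Inputs.integral_gridPath [IsProbabilityMeasure P] [P.IsComplete]
    (hin : Inputs P r ξ W N) {Y : Ω → ℝ} {s : ℝ≥0} (hY : Measurable[past P ξ W N s] Y)
    {G : Ω → ℂ} (hG : Measurable[past P ξ W N s] G) {C : ℝ} (hC : ∀ ω, ‖G ω‖ ≤ C)
    (l : ℝ) (h : ℝ≥0) (k : ℕ) :
    ∫ ω, G ω * Complex.exp (l * gridPath Y W N s h k ω * Complex.I) ∂P =
      (decay r l h ^ k : ℝ) * ∫ ω, G ω * Complex.exp (l * Y ω * Complex.I) ∂P +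
        ((1 - decay r 0 h) * ∑ j ∈ Finset.range k, decay r l h ^ j : ℝ) * ∫ ω, G ω ∂P := by
  induction k with
  | zero => simp [gridPath, gridReset]
  | succ k ih =>
    rw [hin.integral_gridPath_succ hY hG hC, ih, geom_sum_succ]
    push_cast
    ring

/-- The Markov property of the process before reflection, on the level of characteristic functions:
given the past at time `s`, the value at time `s + t` has a characteristic function which depends
on the value at time `s` only. -/
lemma Inputs.integral_exp_signedPath [IsProbabilityMeasure P] [P.IsComplete] (hr : 0 < r)
    (hin : Inputs P r ξ W N) {s : ℝ≥0}
    {G : Ω → ℂ} (hG : Measurable[past P ξ W N s] G) {C : ℝ} (hC : ∀ ω, ‖G ω‖ ≤ C)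
    (l : ℝ) (t : ℝ≥0) :
    ∫ ω, G ω * Complex.exp (l * signedPath ξ W N (s + t) ω * Complex.I) ∂P =
      (decay r l t : ℝ) * ∫ ω, G ω * Complex.exp (l * signedPath ξ W N s ω * Complex.I) ∂P +
        (r / (r + l ^ 2) * (1 - decay r l t) : ℝ) * ∫ ω, G ω ∂P := by
  have hY := hin.measurable_past_signedPath (le_refl s)
  have hGm : Measurable G := hG.mono (hin.past_le s) le_rfl
  have hlim : Tendsto (fun m : ℕ => ∫ ω, G ω * Complex.exp
      (l * gridPath (signedPath ξ W N s) W N s (t / (m + 1 : ℕ)) (m + 1) ω * Complex.I) ∂P)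
      atTop (𝓝 (∫ ω, G ω * Complex.exp (l * signedPath ξ W N (s + t) ω * Complex.I) ∂P)) := by
    refine tendsto_integral_of_dominated_convergence (fun _ => C) (fun m => ?_)
      (integrable_const C) (fun m => Eventually.of_forall fun ω => ?_) ?_
    · have := (measurable_past_gridPath hY (t / (m + 1 : ℕ)) (m + 1)).mono (hin.past_le _) le_rfl
      exact Measurable.aestronglyMeasurable (by fun_prop)
    · rw [norm_mul, ← Complex.ofReal_mul, Complex.norm_exp_ofReal_mul_I, mul_one]
      exact hC ω
    · filter_upwards [hin.tendsto_gridPath s t] with ω hω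
      refine Tendsto.const_mul _ ?_
      exact ((by fun_prop : Continuous fun x : ℝ => Complex.exp (l * x * Complex.I)).tendsto _).comp
        hω
  refine tendsto_nhds_unique hlim ?_
  simp_rw [hin.integral_gridPath hY hG hC, decay_pow]
  refine Tendsto.add (Tendsto.mul_const _ ?_) (Tendsto.mul_const _ ?_)
  · refine tendsto_const_nhds.congr fun m => ?_
    rw [mul_div_cancel₀ t (by positivity)]
  · simp_rw [← decay_pow]
    exact (Complex.continuous_ofReal.tendsto _).comp (tendsto_reset_sum hr l t)

end

/-! ### Transition kernels and the invariant exponential law -/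

section

variable {Ω : Type*} [mΩ : MeasurableSpace Ω] {P : Measure Ω}
  {r : ℝ≥0} {ξ : Ω → ℝ} {W : ℝ≥0 → Ω → ℝ} {N : ℝ≥0 → Ω → ℕ}

lemma integral_measure_comp {α β : Type*} [MeasurableSpace α] [MeasurableSpace β] {μ : Measure α}
    [SFinite μ] {κ : Kernel α β} [IsSFiniteKernel κ] {E : Type*} [NormedAddCommGroup E]
    [NormedSpace ℝ E] {f : β → E} (hf : Integrable f (κ ∘ₘ μ)) :
    ∫ y, f y ∂(κ ∘ₘ μ) = ∫ x, ∫ y, f y ∂κ x ∂μ := by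
  rw [← Measure.snd_compProd] at hf ⊢
  rw [Measure.snd, integral_map measurable_snd.aemeasurable hf.aestronglyMeasurable]
  exact Measure.integral_compProd (f := fun p : α × β => f p.2)
    ((integrable_map_measure hf.aestronglyMeasurable measurable_snd.aemeasurable).1 hf)

/-- The same noises, started at a fixed point. -/
lemma Inputs.const [IsProbabilityMeasure P] (h : Inputs P r ξ W N) (x : ℝ) :
    Inputs P r (fun _ => x) W N where
  measurable_start := measurable_const
  measurable_brownian := h.measurable_brownian
  measurable_poisson := h.measurable_poisson
  brownian := h.brownian
  poisson := h.poisson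
  indep := h.indep
  indep_start := indepFun_const_left x _

lemma Inputs.measurable_signedPath [P.IsComplete] (h : Inputs P r ξ W N) (t : ℝ≥0) :
    Measurable (signedPath ξ W N t) :=
  (h.measurable_past_signedPath (le_refl t)).mono (h.past_le t) le_rfl

lemma signedPath_eq_add {Ω : Type*} (ξ : Ω → ℝ) (W : ℝ≥0 → Ω → ℝ) (N : ℝ≥0 → Ω → ℕ)
    (t : ℝ≥0) (ω : Ω) :
    signedPath ξ W N t ω =
      (if N t ω = 0 then ξ ω else 0) + signedPath (fun _ => 0) W N t ω := by
  simp [signedPath, resetPath]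

lemma resetRBM_eq {Ω : Type*} (ξ : Ω → ℝ) (W : ℝ≥0 → Ω → ℝ) (N : ℝ≥0 → Ω → ℕ) (t : ℝ≥0) (ω : Ω) :
    resetRBM ξ W N t ω = |signedPath ξ W N t ω| := rfl

lemma Inputs.measurable_past_resetRBM (h : Inputs P r ξ W N) {t u : ℝ≥0} (htu : t ≤ u) :
    Measurable[past P ξ W N u] (resetRBM ξ W N t) :=
  measurable_abs.comp (h.measurable_past_signedPath htu)

lemma Inputs.measurable_resetRBM [P.IsComplete] (h : Inputs P r ξ W N) (t : ℝ≥0) :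
    Measurable (resetRBM ξ W N t) :=
  measurable_abs.comp (h.measurable_signedPath t)

/-- The transition kernel of the process before reflection. -/
def Inputs.signedKernel [IsProbabilityMeasure P] [P.IsComplete] (h : Inputs P r ξ W N) (t : ℝ≥0) :
    Kernel ℝ ℝ where
  toFun x := P.map (signedPath (fun _ => x) W N t)
  measurable' := by
    refine Measure.measurable_of_measurable_coe _ fun A hA => ?_
    have hm : Measurable fun p : ℝ × Ω =>
        (if N t p.2 = 0 then p.1 else 0) + signedPath (fun _ => 0) W N t p.2 := by
      refine Measurable.add (Measurable.ite ?_ measurable_fst measurable_const)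
        (((h.const 0).measurable_signedPath t).comp measurable_snd)
      exact ((h.measurable_poisson t).comp measurable_snd) (measurableSet_singleton 0)
    convert measurable_measure_prodMk_left (ν := P) (hm hA) using 2 with x
    rw [Measure.map_apply ((h.const x).measurable_signedPath t) hA]
    congr 1
    ext ω
    simp only [mem_preimage]
    rw [signedPath_eq_add]

section

variable [IsProbabilityMeasure P] [P.IsComplete]

lemma Inputs.signedKernel_apply (h : Inputs P r ξ W N) (t : ℝ≥0) (x : ℝ) :
    h.signedKernel t x = P.map (signedPath (fun _ => x) W N t) := rfl

instance (h : Inputs P r ξ W N) (t : ℝ≥0) : IsMarkovKernel (h.signedKernel t) :=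
  ⟨fun x => Measure.isProbabilityMeasure_map
    ((h.const x).measurable_signedPath t).aemeasurable⟩

lemma Inputs.charFun_signedKernel (hr : 0 < r) (h : Inputs P r ξ W N) (t : ℝ≥0) (x l : ℝ) :
    charFun (h.signedKernel t x) l = (decay r l t : ℝ) * Complex.exp (l * x * Complex.I) +
      (r / (r + l ^ 2) * (1 - decay r l t) : ℝ) := by
  have h1 := (h.const x).integral_exp_signedPath hr (s := 0) (G := fun _ => 1)
    measurable_const (C := 1) (by simp) l t
  have h2 : ∫ ω, Complex.exp (l * signedPath (fun _ => x) W N 0 ω * Complex.I) ∂P =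
      Complex.exp (l * x * Complex.I) := by
    rw [integral_congr_ae (g := fun _ => Complex.exp (l * x * Complex.I))]
    · simp
    · filter_upwards [signedPath_zero (h.const x)] with ω hω
      rw [hω]
  simp only [one_mul, zero_add, h2, integral_const, probReal_univ, one_smul, mul_one] at h1
  rw [charFun_apply_real, h.signedKernel_apply,
    integral_map ((h.const x).measurable_signedPath t).aemeasurable (by fun_prop), h1]

lemma integrable_exp_mul_I (ν : Measure ℝ) [IsFiniteMeasure ν] (l : ℝ) :
    Integrable (fun x : ℝ => Complex.exp (l * x * Complex.I)) ν := by
  refine Integrable.of_bound (by fun_prop) 1 (Eventually.of_forall fun x => ?_)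
  rw [← Complex.ofReal_mul, Complex.norm_exp_ofReal_mul_I]

/-- The effect of the transition kernel on characteristic functions. -/
lemma Inputs.charFun_signedKernel_comp (hr : 0 < r) (h : Inputs P r ξ W N) (t : ℝ≥0)
    (ν : Measure ℝ) [IsFiniteMeasure ν] (l : ℝ) :
    charFun (h.signedKernel t ∘ₘ ν) l = (decay r l t : ℝ) * charFun ν l +
      (r / (r + l ^ 2) * (1 - decay r l t) : ℝ) * (ν.real univ : ℝ) := by
  rw [charFun_apply_real, integral_measure_comp (integrable_exp_mul_I _ l)]
  simp_rw [← charFun_apply_real, h.charFun_signedKernel hr]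
  rw [integral_add ((integrable_exp_mul_I _ l).const_mul _) (integrable_const _),
    integral_const_mul, integral_const, ← charFun_apply_real]
  simp [mul_comm]

/-- The Markov property of the process before reflection, on an event `A` of the past. -/
lemma Inputs.map_restrict_signedPath (hr : 0 < r) (h : Inputs P r ξ W N) {s : ℝ≥0} {A : Set Ω}
    (hA : MeasurableSet[past P ξ W N s] A) (t : ℝ≥0) :
    (P.restrict A).map (signedPath ξ W N (s + t)) =
      h.signedKernel t ∘ₘ ((P.restrict A).map (signedPath ξ W N s)) := by
  have hAm : MeasurableSet A := h.past_le s A hA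
  have hG : Measurable[past P ξ W N s] (A.indicator fun _ => (1 : ℂ)) :=
    Measurable.indicator measurable_const hA
  have hG1 : ∀ ω, ‖A.indicator (fun _ => (1 : ℂ)) ω‖ ≤ 1 := fun ω => by
    by_cases hω : ω ∈ A <;> simp [hω]
  have hind : ∀ f : Ω → ℂ, ∫ ω, A.indicator (fun _ => (1 : ℂ)) ω * f ω ∂P = ∫ ω in A, f ω ∂P := by
    intro f
    rw [← integral_indicator hAm]
    congr 1
    ext ω
    by_cases hω : ω ∈ A <;> simp [hω]
  refine Measure.ext_of_charFun (funext fun l => ?_)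
  have h1 := h.integral_exp_signedPath hr hG hG1 l t
  have h2 := hind fun _ => 1
  simp only [mul_one] at h2
  rw [hind, hind, h2] at h1
  rw [h.charFun_signedKernel_comp hr, charFun_apply_real, charFun_apply_real,
    integral_map (h.measurable_signedPath _).aemeasurable (by fun_prop),
    integral_map (h.measurable_signedPath _).aemeasurable (by fun_prop), h1]
  congr 2
  rw [map_measureReal_apply (h.measurable_signedPath _) MeasurableSet.univ]
  simp

lemma Inputs.lintegral_mul_signedPath (hr : 0 < r) (h : Inputs P r ξ W N) {s : ℝ≥0}
    {G : Ω → ℝ≥0∞} (hG : Measurable[past P ξ W N s] G) (t : ℝ≥0) {g : ℝ → ℝ≥0∞}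
    (hg : Measurable g) :
    ∫⁻ ω, G ω * g (signedPath ξ W N (s + t) ω) ∂P =
      ∫⁻ ω, G ω * ∫⁻ y, g y ∂h.signedKernel t (signedPath ξ W N s ω) ∂P := by
  have hY := fun t => h.measurable_signedPath t
  have hK : Measurable fun x => ∫⁻ y, g y ∂h.signedKernel t x := hg.lintegral_kernel
  have hg1 : Measurable fun ω => g (signedPath ξ W N (s + t) ω) := hg.comp (hY (s + t))
  have hg2 : Measurable fun ω => ∫⁻ y, g y ∂h.signedKernel t (signedPath ξ W N s ω) :=
    hK.comp (hY s)
  have hle := h.past_le s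
  refine @Measurable.ennreal_induction Ω (past P ξ W N s) (fun G =>
    ∫⁻ ω, G ω * g (signedPath ξ W N (s + t) ω) ∂P =
      ∫⁻ ω, G ω * ∫⁻ y, g y ∂h.signedKernel t (signedPath ξ W N s ω) ∂P) ?_ ?_ ?_ G hG
  · intro c A hA
    have hAm := hle A hA
    have hind : ∀ f : Ω → ℝ≥0∞, Measurable f →
        ∫⁻ ω, A.indicator (fun _ => c) ω * f ω ∂P = c * ∫⁻ ω in A, f ω ∂P := by
      intro f hf
      rw [← lintegral_const_mul c hf, ← lintegral_indicator hAm]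
      congr 1
      ext ω
      by_cases hω : ω ∈ A <;> simp [hω]
    rw [hind _ hg1, hind _ hg2]
    congr 1
    have h1 := congrArg (fun m => ∫⁻ y, g y ∂m) (h.map_restrict_signedPath hr hA t)
    beta_reduce at h1
    rwa [Measure.lintegral_bind (Kernel.aemeasurable _) hg.aemeasurable, lintegral_map hg (hY _),
      lintegral_map hK (hY _)] at h1
  · intro f₁ f₂ _ hf₁ hf₂ ih₁ ih₂
    have hm := hf₁.mono hle le_rfl
    simp only [Pi.add_apply, add_mul]
    rw [lintegral_add_left (hm.fun_mul hg1), lintegral_add_left (hm.fun_mul hg2), ih₁, ih₂]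
  · intro f hf hmono ih
    have hm := fun n => (hf n).mono hle le_rfl
    have hmul : ∀ q : Ω → ℝ≥0∞, Measurable q → ∫⁻ ω, (⨆ n, f n ω) * q ω ∂P =
        ⨆ n, ∫⁻ ω, f n ω * q ω ∂P := by
      intro q hq
      simp_rw [ENNReal.iSup_mul]
      exact lintegral_iSup (fun n => (hm n).mul hq) fun i j hij ω => by
        gcongr
        exact hmono hij ω
    beta_reduce
    rw [hmul _ hg1, hmul _ hg2]
    exact iSup_congr ih

/-- Starting from `-x` amounts to flipping the path started from `x`. -/
lemma Inputs.signedKernel_neg (hr : 0 < r) (h : Inputs P r ξ W N) (t : ℝ≥0) (x : ℝ) :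
    h.signedKernel t (-x) = (h.signedKernel t x).map Neg.neg := by
  have : (Neg.neg : ℝ → ℝ) = fun y => (-1) * y := by ext; simp
  refine Measure.ext_of_charFun (funext fun l => ?_)
  rw [this, charFun_map_mul, h.charFun_signedKernel hr, h.charFun_signedKernel hr]
  simp [decay]

/-- The transition kernel of the reflected process. -/
def Inputs.absKernel (h : Inputs P r ξ W N) (t : ℝ≥0) : Kernel ℝ ℝ :=
  (h.signedKernel t).map abs

instance (h : Inputs P r ξ W N) (t : ℝ≥0) : IsMarkovKernel (h.absKernel t) :=
  Kernel.IsMarkovKernel.map _ measurable_abs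

lemma Inputs.absKernel_apply (h : Inputs P r ξ W N) (t : ℝ≥0) (x : ℝ) :
    h.absKernel t x = forwardLaw P W N t x := by
  rw [absKernel, Kernel.map_apply _ measurable_abs, h.signedKernel_apply,
    Measure.map_map measurable_abs ((h.const x).measurable_signedPath t)]
  rfl

lemma Inputs.absKernel_neg (hr : 0 < r) (h : Inputs P r ξ W N) (t : ℝ≥0) (x : ℝ) :
    h.absKernel t (-x) = h.absKernel t x := by
  rw [absKernel, Kernel.map_apply _ measurable_abs, Kernel.map_apply _ measurable_abs,
    h.signedKernel_neg hr, Measure.map_map measurable_abs measurable_neg]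
  congr 1
  ext y
  simp

lemma Inputs.absKernel_abs (hr : 0 < r) (h : Inputs P r ξ W N) (t : ℝ≥0) (x : ℝ) :
    h.absKernel t |x| = h.absKernel t x := by
  rcases abs_choice x with hx | hx <;> simp [hx, h.absKernel_neg hr]

/-- The Markov property of the reflected process: by symmetry, the law of `|Y (s + t)|` given the
past depends on `|Y s|` only. -/
lemma Inputs.lintegral_mul_resetRBM (hr : 0 < r) (h : Inputs P r ξ W N) {s : ℝ≥0}
    {G : Ω → ℝ≥0∞} (hG : Measurable[past P ξ W N s] G) (t : ℝ≥0) {g : ℝ → ℝ≥0∞}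
    (hg : Measurable g) :
    ∫⁻ ω, G ω * g (resetRBM ξ W N (s + t) ω) ∂P =
      ∫⁻ ω, G ω * ∫⁻ y, g y ∂h.absKernel t (resetRBM ξ W N s ω) ∂P := by
  simp_rw [resetRBM_eq, h.absKernel_abs hr, absKernel, Kernel.map_apply _ measurable_abs,
    lintegral_map hg measurable_abs]
  exact h.lintegral_mul_signedPath hr hG t (hg.comp measurable_abs)

end

lemma expMeasure_eq (c : ℝ) : expMeasure c =
    (volume.restrict (Ioi 0)).withDensity fun x => ENNReal.ofReal (c * Real.exp (-(c * x))) := by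
  rw [← restrict_withDensity measurableSet_Ioi, expMeasure, gammaMeasure]
  have h0 : (volume.withDensity (gammaPDF 1 c)) (Ioi 0)ᶜ = 0 := by
    rw [withDensity_apply _ measurableSet_Ioi.compl, compl_Ioi,
      setLIntegral_congr (Iio_ae_eq_Iic (a := (0 : ℝ))).symm]
    exact lintegral_gammaPDF_of_nonpos le_rfl
  rw [← Measure.restrict_eq_self_of_ae_mem (s := Ioi 0) (mem_ae_iff.2 h0),
    restrict_withDensity measurableSet_Ioi, restrict_withDensity measurableSet_Ioi]
  refine withDensity_congr_ae ?_
  filter_upwards [ae_restrict_mem measurableSet_Ioi] with x hx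
  exact exponentialPDF_of_nonneg (le_of_lt hx)

lemma ae_expMeasure_pos (c : ℝ) : ∀ᵐ x ∂expMeasure c, 0 < x := by
  rw [expMeasure_eq]
  exact (withDensity_absolutelyContinuous _ _).ae_le (ae_restrict_mem measurableSet_Ioi)

lemma charFun_expMeasure {c : ℝ} (hc : 0 < c) (l : ℝ) :
    charFun (expMeasure c) l = c / (c - l * Complex.I) := by
  have hm : Measurable fun x => (c * Real.exp (-(c * x))).toNNReal := by fun_prop
  have he := expMeasure_eq c
  simp only [ENNReal.ofReal] at he
  rw [charFun_apply_real, he, integral_withDensity_eq_integral_smul hm]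
  have hre : (-(c - l * Complex.I) : ℂ).re < 0 := by simpa using hc
  have h1 := integral_exp_mul_complex_Ioi hre 0
  have h2 : ∀ x : ℝ, (c * Real.exp (-(c * x))).toNNReal • Complex.exp (l * x * Complex.I) =
      c * Complex.exp (-(c - l * Complex.I) * x) := fun x => by
    rw [NNReal.smul_def, Real.coe_toNNReal _ (by positivity), Complex.real_smul]
    push_cast
    rw [mul_assoc, ← Complex.exp_add]
    congr 2
    ring
  simp_rw [h2]
  rw [integral_const_mul, h1]
  rw [neg_div_neg_eq, Complex.ofReal_zero, mul_zero, Complex.exp_zero, mul_one_div]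

/-- The symmetrised exponential law has a Cauchy-type characteristic function, which is the fixed
point of the recursion of `Inputs.charFun_signedKernel_comp`. -/
lemma charFun_symm_expMeasure (hr : 0 < r) (l : ℝ) :
    charFun (expMeasure (√r) + (expMeasure (√r)).map Neg.neg) l = (2 * (r / (r + l ^ 2)) : ℝ) := by
  have hs : 0 < √(r : ℝ) := Real.sqrt_pos.2 hr
  have := isProbabilityMeasure_expMeasure hs
  have hneg : (Neg.neg : ℝ → ℝ) = fun y => (-1) * y := by ext; simp
  have : IsFiniteMeasure ((expMeasure (√r)).map Neg.neg) := inferInstance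
  have hadd : charFun (expMeasure (√r) + (expMeasure (√r)).map Neg.neg) l =
      charFun (expMeasure (√r)) l + charFun ((expMeasure (√r)).map Neg.neg) l := by
    simp only [charFun_apply_real]
    exact integral_add_measure (integrable_exp_mul_I _ l) (integrable_exp_mul_I _ l)
  rw [hadd, hneg, charFun_map_mul, charFun_expMeasure hs, charFun_expMeasure hs]
  have hsq : ((√(r : ℝ) : ℝ) : ℂ) ^ 2 = ((r : ℝ) : ℂ) := by
    rw [← Complex.ofReal_pow, Real.sq_sqrt (NNReal.coe_nonneg r)]
  have h1 : ((√(r : ℝ) : ℝ) : ℂ) - l * Complex.I ≠ 0 := fun hz => by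
    have := congrArg Complex.re hz
    simp [hr.ne'] at this
  have h2 : ((√(r : ℝ) : ℝ) : ℂ) + l * Complex.I ≠ 0 := fun hz => by
    have := congrArg Complex.re hz
    simp [hr.ne'] at this
  have h3 : ((r : ℝ) + l ^ 2 : ℂ) =
      ((√(r : ℝ) : ℝ) - l * Complex.I) * ((√(r : ℝ) : ℝ) + l * Complex.I) := by
    rw [← hsq]
    linear_combination ((l : ℂ) ^ 2) * Complex.I_sq
  push_cast
  rw [h3, ← hsq]
  have h4 : ((√(r : ℝ) : ℝ) : ℂ) - (-1 * l) * Complex.I = (√(r : ℝ) : ℝ) + l * Complex.I := by ring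
  rw [h4]
  field_simp
  ring

/-- The exponential law of parameter `√r` is invariant. -/
lemma Inputs.absKernel_comp_expMeasure [IsProbabilityMeasure P] [P.IsComplete] (hr : 0 < r)
    (h : Inputs P r ξ W N) (t : ℝ≥0) :
    h.absKernel t ∘ₘ expMeasure (√r) = expMeasure (√r) := by
  have hs : 0 < √(r : ℝ) := Real.sqrt_pos.2 hr
  have := isProbabilityMeasure_expMeasure hs
  set μ := expMeasure (√r) with hμ
  have hmass : (μ + μ.map Neg.neg).real univ = 2 := by
    rw [measureReal_add_apply, map_measureReal_apply measurable_neg MeasurableSet.univ]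
    simp
    norm_num
  -- the symmetrised law is invariant for the process before reflection
  have h1 : h.signedKernel t ∘ₘ (μ + μ.map Neg.neg) = μ + μ.map Neg.neg := by
    refine Measure.ext_of_charFun (funext fun l => ?_)
    rw [h.charFun_signedKernel_comp hr, hmass, charFun_symm_expMeasure hr]
    push_cast
    ring
  have habs : μ.map abs = μ := by
    rw [Measure.map_congr (g := id), Measure.map_id]
    filter_upwards [ae_expMeasure_pos (√r)] with x hx
    exact abs_of_pos hx
  have h2 : (μ.map Neg.neg).map abs = μ := by
    rw [Measure.map_map measurable_abs measurable_neg]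
    conv_rhs => rw [← habs]
    congr 1
    ext y
    simp
  have h3 : h.absKernel t ∘ₘ (μ.map Neg.neg) = h.absKernel t ∘ₘ μ := by
    ext A hA
    rw [Measure.bind_apply hA (Kernel.aemeasurable _),
      Measure.bind_apply hA (Kernel.aemeasurable _),
      lintegral_map (Kernel.measurable_coe _ hA) measurable_neg]
    simp_rw [h.absKernel_neg hr]
  have h4 := congrArg (Measure.map abs) h1
  rw [Measure.map_comp _ _ measurable_abs, Measure.map_add _ _ measurable_abs, habs, h2,
    ← absKernel, Measure.comp_add, h3] at h4
  ext A hA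
  have h5 := congrArg (fun m : Measure ℝ => m A) h4
  beta_reduce at h5
  rw [Measure.add_apply, Measure.add_apply, ← two_mul, ← two_mul] at h5
  exact (ENNReal.mul_right_inj two_ne_zero ENNReal.ofNat_ne_top).1 h5

end

/-! ### The Markov property of the reversed process -/

section

variable {Ω : Type*} [mΩ : MeasurableSpace Ω] {P : Measure Ω} [IsProbabilityMeasure P]
  [P.IsComplete] {r : ℝ≥0} {ξ : Ω → ℝ} {W : ℝ≥0 → Ω → ℝ} {N : ℝ≥0 → Ω → ℕ}

lemma isProbabilityMeasure_expMeasure_sqrt (hr : 0 < r) :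
    IsProbabilityMeasure (expMeasure (√r)) :=
  isProbabilityMeasure_expMeasure (Real.sqrt_pos.2 (NNReal.coe_pos.2 hr))

/-- Started from its invariant law, the reflected process is stationary. -/
lemma Inputs.map_resetRBM (hr : 0 < r) (h : Inputs P r ξ W N)
    (hξ : HasLaw ξ (expMeasure (√r)) P) (t : ℝ≥0) :
    P.map (resetRBM ξ W N t) = expMeasure (√r) := by
  have h0 : P.map (resetRBM ξ W N 0) = expMeasure (√r) := by
    rw [← hξ.map_eq]
    refine Measure.map_congr ?_
    have hpos : ∀ᵐ ω ∂P, 0 < ξ ω :=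
      (hξ.ae_iff (p := fun x => 0 < x) (by fun_prop)).2 (ae_expMeasure_pos _)
    filter_upwards [signedPath_zero h, hpos] with ω hω hω'
    rw [resetRBM_eq, hω, abs_of_pos hω']
  ext A hA
  have h1 := h.lintegral_mul_resetRBM hr (s := 0) (G := fun _ => 1) measurable_const t
    (measurable_one.indicator hA)
  simp only [one_mul, zero_add, lintegral_indicator_one hA] at h1
  rw [← h.absKernel_comp_expMeasure hr t, Measure.bind_apply hA (Kernel.aemeasurable _), ← h0,
    lintegral_map (Kernel.measurable_coe _ hA) (h.measurable_resetRBM 0), ← h1,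
    Measure.map_apply (h.measurable_resetRBM t) hA, ← lintegral_indicator_one
      (h.measurable_resetRBM t hA)]
  rfl

lemma Inputs.map_resetRBM_prod (hr : 0 < r) (h : Inputs P r ξ W N)
    (hξ : HasLaw ξ (expMeasure (√r)) P) (s t : ℝ≥0) :
    P.map (fun ω => (resetRBM ξ W N s ω, resetRBM ξ W N (s + t) ω)) =
      expMeasure (√r) ⊗ₘ h.absKernel t := by
  have := isProbabilityMeasure_expMeasure_sqrt hr
  have hX := h.measurable_resetRBM
  have : IsFiniteMeasure (P.map (fun ω => (resetRBM ξ W N s ω, resetRBM ξ W N (s + t) ω))) :=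
    inferInstance
  refine Measure.ext_prod fun {A B} hA hB => ?_
  have h1 := h.lintegral_mul_resetRBM hr
    (G := fun ω => A.indicator 1 (resetRBM ξ W N s ω))
    ((measurable_one.indicator hA).comp (h.measurable_past_resetRBM le_rfl)) t
    (measurable_one.indicator hB)
  simp only [lintegral_indicator_one hB] at h1
  have hm : Measurable fun x => A.indicator 1 x * h.absKernel t x B :=
    (measurable_one.indicator hA).mul (Kernel.measurable_coe _ hB)
  rw [Measure.map_apply ((hX s).prodMk (hX (s + t))) (hA.prod hB),
    Measure.compProd_apply_prod hA hB, ← h.map_resetRBM hr hξ s, ← lintegral_indicator hA,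
    ← lintegral_indicator_one (((hX s).prodMk (hX (s + t))) (hA.prod hB))]
  calc _ = ∫⁻ ω, A.indicator 1 (resetRBM ξ W N s ω) * B.indicator 1 (resetRBM ξ W N (s + t) ω) ∂P :=
        by
          congr 1
          ext ω
          by_cases h1 : resetRBM ξ W N s ω ∈ A <;>
            by_cases h2 : resetRBM ξ W N (s + t) ω ∈ B <;> simp [indicator, h1, h2]
    _ = _ := by
        rw [h1, ← lintegral_map hm (hX s)]
        congr 1
        ext x
        by_cases hx : x ∈ A <;> simp [hx]

/-- The joint law of the reversed process at the times `0` and `t` is the swapped joint law of the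
stationary process at two times at the distance `t`. -/
lemma Inputs.compProd_condDistrib (hr : 0 < r) (h : Inputs P r ξ W N)
    (hξ : HasLaw ξ (expMeasure (√r)) P) {T t : ℝ≥0} (htT : t ≤ T) :
    expMeasure (√r) ⊗ₘ condDistrib (timeReversal T (resetRBM ξ W N) t)
        (timeReversal T (resetRBM ξ W N) 0) P =
      (expMeasure (√r) ⊗ₘ h.absKernel t).map Prod.swap := by
  have hX := h.measurable_resetRBM
  have h0 : timeReversal T (resetRBM ξ W N) 0 = resetRBM ξ W N T := by
    ext ω
    simp [timeReversal]
  have ht : timeReversal T (resetRBM ξ W N) t = resetRBM ξ W N (T - t) := rfl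
  rw [h0, ht, ← h.map_resetRBM hr hξ T, compProd_map_condDistrib (hX _).aemeasurable,
    h.map_resetRBM hr hξ T, ← h.map_resetRBM_prod hr hξ (T - t) t, tsub_add_cancel_of_le htT,
    Measure.map_map measurable_swap ((hX _).prodMk (hX _))]
  rfl

/-- Functionals of the process at finitely many times after `a` can be replaced, under expectations
against functionals of the past at time `a`, by a function of the value at time `a`. -/
lemma Inputs.exists_lintegral_mul_prod (hr : 0 < r) (h : Inputs P r ξ W N) {f : ℝ≥0 → ℝ → ℝ≥0∞}
    (hf : ∀ i, Measurable (f i)) (I : Finset ℝ≥0) (a : ℝ≥0) (ha : ∀ i ∈ I, a ≤ i) :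
    ∃ φ : ℝ → ℝ≥0∞, Measurable φ ∧ ∀ G : Ω → ℝ≥0∞, Measurable[past P ξ W N a] G →
      ∫⁻ ω, G ω * ∏ i ∈ I, f i (resetRBM ξ W N i ω) ∂P =
        ∫⁻ ω, G ω * φ (resetRBM ξ W N a ω) ∂P := by
  induction I using Finset.induction_on_min generalizing a with
  | empty => exact ⟨fun _ => 1, measurable_const, fun G _ => by simp⟩
  | insert i I hi ih =>
    obtain ⟨φ, hφ, hG⟩ := ih i fun j hj => (hi j hj).le
    have hai : a ≤ i := ha i (by simp)
    have hm : Measurable fun x => f i x * φ x := (hf i).mul hφ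
    refine ⟨fun x => ∫⁻ y, f i y * φ y ∂h.absKernel (i - a) x, hm.lintegral_kernel,
      fun G hGa => ?_⟩
    have hni : i ∉ I := fun hc => (hi i hc).false
    have hGi : Measurable[past P ξ W N i] fun ω => G ω * f i (resetRBM ξ W N i ω) :=
      (hGa.mono (past_mono hai) le_rfl).mul ((hf i).comp (h.measurable_past_resetRBM le_rfl))
    have h1 := h.lintegral_mul_resetRBM hr hGa (i - a) hm
    rw [add_tsub_cancel_of_le hai] at h1
    rw [← h1]
    simp_rw [Finset.prod_insert hni, ← mul_assoc]
    exact hG _ hGi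

/-- The joint law of the reversed path up to time `s` and of the value at time `s + t`. -/
lemma Inputs.map_timeReversal_prod (hr : 0 < r) (h : Inputs P r ξ W N)
    (hξ : HasLaw ξ (expMeasure (√r)) P) {T s t : ℝ≥0} (hst : s + t ≤ T) :
    P.map (fun ω => ((fun u : Iic s => timeReversal T (resetRBM ξ W N) u ω),
        timeReversal T (resetRBM ξ W N) (s + t) ω)) =
      P.map (fun ω (u : Iic s) => timeReversal T (resetRBM ξ W N) u ω) ⊗ₘ
        (condDistrib (timeReversal T (resetRBM ξ W N) t)
          (timeReversal T (resetRBM ξ W N) 0) P).comap (fun x : Iic s → ℝ => x ⟨s, self_mem_Iic⟩)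
          (by fun_prop) := by
  have hX := h.measurable_resetRBM
  set Z := timeReversal T (resetRBM ξ W N) with hZ
  have hZm : ∀ u, Measurable (Z u) := fun u => hX (T - u)
  set κR := condDistrib (Z t) (Z 0) P with hκR
  set Φ : Ω → Iic s → ℝ := fun ω u => Z u ω with hΦ
  have hΦm : Measurable Φ := measurable_pi_lambda _ fun u => hZm u
  have hsT : s ≤ T := le_self_add.trans hst
  set a := T - s with ha
  set b := T - (s + t) with hb
  have hba : b + t = a := by
    rw [hb, ha, ← tsub_tsub, tsub_add_cancel_of_le (le_tsub_of_add_le_left hst)]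
  have hbale : b ≤ a := hba ▸ le_self_add
  -- the pair formed by `X a` and `X b` has the law of `(Z 0, Z t)`
  have hjoint : P.map (fun ω => (resetRBM ξ W N a ω, resetRBM ξ W N b ω)) =
      expMeasure (√r) ⊗ₘ κR := by
    rw [hκR, hZ, h.compProd_condDistrib hr hξ (le_add_self.trans hst),
      ← h.map_resetRBM_prod hr hξ b t, hba, Measure.map_map measurable_swap ((hX _).prodMk (hX _))]
    rfl
  have := isProbabilityMeasure_expMeasure_sqrt hr
  have : IsFiniteMeasure (P.map (fun ω => (Φ ω, Z (s + t) ω))) := inferInstance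
  refine Measure.ext_prod fun {S B} hS hB => ?_
  have hdm : Measurable fun ω => κR (resetRBM ξ W N a ω) B :=
    (Kernel.measurable_coe _ hB).comp (hX a)
  have hfin : IsFiniteMeasure (P.withDensity fun ω => κR (resetRBM ξ W N a ω) B) := by
    refine isFiniteMeasure_withDensity (ne_top_of_le_ne_top ENNReal.one_ne_top ?_)
    calc ∫⁻ ω, κR (resetRBM ξ W N a ω) B ∂P ≤ ∫⁻ _, 1 ∂P := lintegral_mono fun ω => prob_le_one
      _ = 1 := by simp
  have key : (P.restrict (resetRBM ξ W N b ⁻¹' B)).map Φ =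
      (P.withDensity fun ω => κR (resetRBM ξ W N a ω) B).map Φ := by
    -- on a square cylinder both sides reduce to the joint law of `X a` and `X b`
    have hcyl : ∀ (I : Finset (Iic s)) (A : Iic s → Set ℝ), (∀ u, MeasurableSet (A u)) →
        (P.restrict (resetRBM ξ W N b ⁻¹' B)).map Φ ((I : Set (Iic s)).pi A) =
          (P.withDensity fun ω => κR (resetRBM ξ W N a ω) B).map Φ ((I : Set (Iic s)).pi A) := by
      intro I A hA
      have hpi : MeasurableSet ((I : Set (Iic s)).pi A) :=
        MeasurableSet.pi I.countable_toSet fun u _ => hA u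
      let f : ℝ≥0 → ℝ → ℝ≥0∞ := fun i =>
        if hi : T - i ≤ s then (A ⟨T - i, hi⟩).indicator 1 else 1
      have hf : ∀ i, Measurable (f i) := fun i => by
        dsimp only [f]
        split_ifs with hi
        · exact measurable_one.indicator (hA _)
        · exact measurable_one
      have hTT : ∀ u : Iic s, T - (T - u) = (u : ℝ≥0) := fun u =>
        tsub_tsub_cancel_of_le (u.2.trans hsT)
      obtain ⟨φ, hφ, hφG⟩ := h.exists_lintegral_mul_prod hr hf
        (I.image fun u : Iic s => T - (u : ℝ≥0)) a
        (by
          intro i hi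
          obtain ⟨u, -, rfl⟩ := Finset.mem_image.1 hi
          exact tsub_le_tsub_left u.2 T)
      have hprod : ∀ ω, ∏ i ∈ I.image fun u : Iic s => T - (u : ℝ≥0), f i (resetRBM ξ W N i ω) =
          (Φ ⁻¹' (I : Set (Iic s)).pi A).indicator 1 ω := by
        intro ω
        rw [Finset.prod_image fun u _ v _ huv => Subtype.ext (by rw [← hTT u, ← hTT v, huv])]
        have hfu : ∀ u : Iic s, f (T - u) (resetRBM ξ W N (T - u) ω) =
            (A u).indicator 1 (Φ ω u) := by
          intro u
          have hu : T - (T - (u : ℝ≥0)) ≤ s := by rw [hTT]; exact u.2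
          have he : (⟨T - (T - (u : ℝ≥0)), hu⟩ : Iic s) = u := Subtype.ext (hTT u)
          simp only [f, dif_pos hu, he]
          rfl
        simp_rw [hfu]
        by_cases hω : ω ∈ Φ ⁻¹' (I : Set (Iic s)).pi A
        · rw [indicator_of_mem hω]
          exact Finset.prod_eq_one fun u hu => indicator_of_mem (hω u hu) _
        · rw [indicator_of_notMem hω]
          simp only [mem_preimage, Set.mem_pi, not_forall] at hω
          obtain ⟨u, hu, hω⟩ := hω
          exact Finset.prod_eq_zero hu (indicator_of_notMem hω _)
      have hΦS : MeasurableSet (Φ ⁻¹' (I : Set (Iic s)).pi A) := hΦm hpi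
      have h1 := hφG (fun ω => B.indicator 1 (resetRBM ξ W N b ω))
        ((measurable_one.indicator hB).comp (h.measurable_past_resetRBM hbale))
      have h2 := hφG (fun ω => κR (resetRBM ξ W N a ω) B)
        ((Kernel.measurable_coe _ hB).comp (h.measurable_past_resetRBM le_rfl))
      simp_rw [hprod] at h1 h2
      have h3 : ∫⁻ ω, B.indicator 1 (resetRBM ξ W N b ω) * φ (resetRBM ξ W N a ω) ∂P =
          ∫⁻ ω, κR (resetRBM ξ W N a ω) B * φ (resetRBM ξ W N a ω) ∂P := by
        have hm1 : Measurable fun p : ℝ × ℝ => B.indicator (1 : ℝ → ℝ≥0∞) p.2 * φ p.1 :=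
          ((measurable_one.indicator hB).comp measurable_snd).mul (hφ.comp measurable_fst)
        have hm2 : Measurable fun x => κR x B * φ x := (Kernel.measurable_coe _ hB).mul hφ
        rw [← lintegral_map hm2 (hX a), h.map_resetRBM hr hξ,
          ← lintegral_map hm1 ((hX a).prodMk (hX b)), hjoint, Measure.lintegral_compProd hm1]
        congr 1
        ext x
        dsimp only
        rw [lintegral_mul_const _ (measurable_one.indicator hB), lintegral_indicator_one hB]
      rw [Measure.map_apply hΦm hpi, Measure.map_apply hΦm hpi, Measure.restrict_apply hΦS,
        withDensity_apply _ hΦS, ← lintegral_indicator hΦS,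
        ← lintegral_indicator_one (hΦS.inter (hX b hB))]
      calc _ = _ := by
            congr 1
            ext ω
            by_cases hω1 : ω ∈ Φ ⁻¹' (I : Set (Iic s)).pi A <;>
              by_cases hω2 : resetRBM ξ W N b ω ∈ B <;> simp [indicator, hω1, hω2]
        _ = _ := h1
        _ = _ := h3
        _ = _ := h2.symm
        _ = _ := by
            congr 1
            ext ω
            by_cases hω1 : ω ∈ Φ ⁻¹' (I : Set (Iic s)).pi A <;> simp [indicator, hω1]
    refine ext_of_generate_finite _ generateFrom_squareCylinders.symm
      (isPiSystem_squareCylinders (fun _ => MeasurableSpace.isPiSystem_measurableSet) (by simp))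
      ?_ ?_
    · rintro _ ⟨I, A, hA, rfl⟩
      exact hcyl I A fun u => hA u (mem_univ u)
    · simpa using hcyl ∅ (fun _ => univ) fun _ => MeasurableSet.univ
  rw [Measure.map_apply (hΦm.prodMk (hZm _)) (hS.prod hB), Measure.compProd_apply_prod hS hB]
  have hk := congrArg (fun m : Measure (Iic s → ℝ) => m S) key
  beta_reduce at hk
  rw [Measure.map_apply hΦm hS, Measure.map_apply hΦm hS, Measure.restrict_apply (hΦm hS),
    withDensity_apply _ (hΦm hS)] at hk
  rw [setLIntegral_map hS (Kernel.measurable_coe _ hB) hΦm]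
  exact hk

/-- The reversed process is a time-homogeneous Markov process. -/
lemma Inputs.isMarkovWith (hr : 0 < r) (h : Inputs P r ξ W N)
    (hξ : HasLaw ξ (expMeasure (√r)) P) (T : ℝ≥0) :
    IsMarkovWith P T (timeReversal T (resetRBM ξ W N))
      (condLaw P (timeReversal T (resetRBM ξ W N))) := by
  rintro s t hst F ⟨hF, C, hC⟩ g ⟨hg, D, hD⟩
  have hjoint := h.map_timeReversal_prod hr hξ hst
  set Z := timeReversal T (resetRBM ξ W N) with hZ
  have hZm : ∀ u, Measurable (Z u) := fun u => h.measurable_resetRBM (T - u)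
  have hΦm : Measurable fun ω (u : Iic s) => Z u ω := measurable_pi_lambda _ fun u => hZm u
  have hFg : Measurable fun p : (Iic s → ℝ) × ℝ => F p.1 * g p.2 :=
    (hF.comp measurable_fst).mul (hg.comp measurable_snd)
  have hgi : Measurable fun x : Iic s → ℝ =>
      F x * semigroup (condLaw P Z) t g (x ⟨s, self_mem_Iic⟩) := by
    have hκ : Measurable fun x => ∫ y, g y ∂condDistrib (Z t) (Z 0) P x :=
      hg.stronglyMeasurable.integral_kernel.measurable
    have hev : Measurable fun x : Iic s → ℝ => x ⟨s, self_mem_Iic⟩ := by fun_prop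
    exact hF.mul (hκ.comp hev)
  have h1 := integral_map (μ := P) (hΦm.prodMk (hZm (s + t))).aemeasurable
    (f := fun p : (Iic s → ℝ) × ℝ => F p.1 * g p.2) hFg.aestronglyMeasurable
  have h2 := integral_map hΦm.aemeasurable hgi.aestronglyMeasurable (μ := P)
  refine h1.symm.trans (Eq.trans ?_ h2)
  rw [hjoint, Measure.integral_compProd]
  · congr 1
    ext x
    exact integral_const_mul (F x) g
  · refine Integrable.of_bound hFg.aestronglyMeasurable (C * D) (Eventually.of_forall fun p => ?_)
    rw [norm_mul]
    exact mul_le_mul (hC _) (hD _) (norm_nonneg _) ((abs_nonneg _).trans (hC p.1))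

end

/-! ### Duality of the transition operators and of the generators -/

section

section Duality

variable {α : Type*} [MeasurableSpace α] {μ : Measure α} [IsProbabilityMeasure μ]
  {κ η : Kernel α α} [IsMarkovKernel η]

lemma setLIntegral_of_reversed [IsMarkovKernel κ] (h : μ ⊗ₘ η = (μ ⊗ₘ κ).map Prod.swap)
    {A B : Set α} (hA : MeasurableSet A) (hB : MeasurableSet B) :
    ∫⁻ x in A, η x B ∂μ = ∫⁻ y in B, κ y A ∂μ := by
  rw [← Measure.compProd_apply_prod hA hB, ← Measure.compProd_apply_prod hB hA, h,
    Measure.map_apply measurable_swap (hA.prod hB), preimage_swap_prod]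

/-- Under the joint law `μ ⊗ₘ κ` both coordinates have the law `μ`, by time reversal. -/
lemma measurePreserving_snd_of_reversed (h : μ ⊗ₘ η = (μ ⊗ₘ κ).map Prod.swap) :
    MeasurePreserving Prod.snd (μ ⊗ₘ κ) μ := by
  refine ⟨measurable_snd, ?_⟩
  have h1 : (μ ⊗ₘ η).map Prod.fst = μ := Measure.fst_compProd μ η
  rw [h, Measure.map_map measurable_fst measurable_swap] at h1
  exact h1

variable [IsMarkovKernel κ]

lemma aestronglyMeasurable_integral_of_reversed (h : μ ⊗ₘ η = (μ ⊗ₘ κ).map Prod.swap) {f : α → ℝ}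
    (hf : MemLp f 2 μ) : AEStronglyMeasurable (fun x => ∫ y, f y ∂κ x) μ :=
  (hf.comp_measurePreserving (measurePreserving_snd_of_reversed h)).1.integral_kernel_compProd

lemma integrable_mul_of_reversed (h : μ ⊗ₘ η = (μ ⊗ₘ κ).map Prod.swap) {f g : α → ℝ}
    (hf : MemLp f 2 μ) (hg : MemLp g 2 μ) :
    Integrable (fun p : α × α => f p.2 * g p.1) (μ ⊗ₘ κ) :=
  (hf.comp_measurePreserving (measurePreserving_snd_of_reversed h)).integrable_mul
    (hg.comp_measurePreserving ⟨measurable_fst, Measure.fst_compProd μ κ⟩)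

lemma integrable_integral_mul_of_reversed (h : μ ⊗ₘ η = (μ ⊗ₘ κ).map Prod.swap) {f g : α → ℝ}
    (hf : MemLp f 2 μ) (hg : MemLp g 2 μ) :
    Integrable (fun x => (∫ y, f y ∂κ x) * g x) μ := by
  have h1 := (integrable_mul_of_reversed h hf hg : Integrable _ (μ.compProd κ))
  rw [Measure.compProd] at h1
  replace h1 := h1.integral_compProd
  simp only [Kernel.prodMkLeft_apply, Kernel.const_apply] at h1
  refine h1.congr (Eventually.of_forall fun x => ?_)
  exact integral_mul_const (g x) f

lemma integral_mul_of_reversed (h : μ ⊗ₘ η = (μ ⊗ₘ κ).map Prod.swap) {f g : α → ℝ}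
    (hf : MemLp f 2 μ) (hg : MemLp g 2 μ) :
    ∫ x, (∫ y, f y ∂κ x) * g x ∂μ = ∫ x, f x * ∫ y, g y ∂η x ∂μ := by
  have hi := integrable_mul_of_reversed h hf hg
  have h' : μ ⊗ₘ κ = (μ ⊗ₘ η).map Prod.swap := by
    rw [h, Measure.map_map measurable_swap measurable_swap, Prod.swap_swap_eq, Measure.map_id]
  have hi' := integrable_mul_of_reversed h' hg hf
  calc ∫ x, (∫ y, f y ∂κ x) * g x ∂μ = ∫ p, f p.2 * g p.1 ∂(μ ⊗ₘ κ) := by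
        rw [Measure.integral_compProd hi]
        simp_rw [integral_mul_const]
    _ = ∫ p, f p.1 * g p.2 ∂(μ ⊗ₘ η) := by
        rw [h, integral_map measurable_swap.aemeasurable]
        · rfl
        · rw [← h]
          simpa only [mul_comm] using hi'.1
    _ = _ := by
        rw [Measure.integral_compProd (by simpa only [mul_comm] using hi')]
        simp_rw [integral_const_mul]

end Duality

/-- The pairing of the difference quotients with `g` converges, by the Cauchy–Schwarz inequality. -/
lemma IsGenerator.tendsto_integral_mul {μ : Measure ℝ} {S : ℝ≥0 → (ℝ → ℝ) → ℝ → ℝ}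
    {f h g : ℝ → ℝ} (hf : IsGenerator μ S f h) (hg : MemLp g 2 μ)
    (hS : ∀ᶠ t in 𝓝[>] 0, AEStronglyMeasurable (S t f) μ ∧
      Integrable (fun x => S t f x * g x) μ) :
    Tendsto (fun t : ℝ≥0 => (∫ x, S t f x * g x ∂μ - ∫ x, f x * g x ∂μ) / t) (𝓝[>] 0)
      (𝓝 (∫ x, h x * g x ∂μ)) := by
  obtain ⟨hf, hh, hlim⟩ := hf
  rw [tendsto_iff_edist_tendsto_0]
  have hz : Tendsto (fun t : ℝ≥0 => eLpNorm (fun x => (S t f x - f x) / t - h x) 2 μ *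
      eLpNorm g 2 μ) (𝓝[>] 0) (𝓝 0) := by
    simpa using ENNReal.Tendsto.mul_const hlim (Or.inr hg.eLpNorm_ne_top)
  refine tendsto_of_tendsto_of_tendsto_of_le_of_le' tendsto_const_nhds hz
    (Eventually.of_forall fun _ => zero_le) ?_
  filter_upwards [hS] with t ⟨hm, hi⟩
  have hD : AEStronglyMeasurable (fun x => (S t f x - f x) / t - h x) μ :=
    ((hm.sub hf.1).div₀ aestronglyMeasurable_const).sub hh.1
  have hfg : Integrable (fun x => f x * g x) μ := hf.integrable_mul hg
  have hhg : Integrable (fun x => h x * g x) μ := hh.integrable_mul hg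
  have hi2 : Integrable (fun x => (S t f x * g x - f x * g x) / (t : ℝ)) μ :=
    (hi.sub hfg).div_const _
  have e : (∫ x, S t f x * g x ∂μ - ∫ x, f x * g x ∂μ) / t - ∫ x, h x * g x ∂μ =
      ∫ x, ((S t f x - f x) / t - h x) * g x ∂μ := by
    rw [← integral_sub hi hfg, ← integral_div, ← integral_sub hi2 hhg]
    congr 1
    ext x
    ring
  rw [edist_eq_enorm_sub, e]
  refine (enorm_integral_le_lintegral_enorm _).trans ?_
  have := eLpNorm_smul_le_mul_eLpNorm (p := 2) (q := 2) (r := 1) hg.1 hD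
  rw [eLpNorm_one_eq_lintegral_enorm] at this
  simpa using this

variable {Ω : Type*} [MeasurableSpace Ω] {P : Measure Ω} [IsProbabilityMeasure P] [P.IsComplete]
  {r : ℝ≥0} {ξ : Ω → ℝ} {W : ℝ≥0 → Ω → ℝ} {N : ℝ≥0 → Ω → ℕ}

lemma Inputs.forwardLaw_eq (h : Inputs P r ξ W N) : forwardLaw P W N = fun t x => h.absKernel t x :=
  funext fun t => funext fun x => (h.absKernel_apply t x).symm

lemma Inputs.setLIntegral_condLaw (hr : 0 < r) (h : Inputs P r ξ W N)
    (hξ : HasLaw ξ (expMeasure (√r)) P) {T t : ℝ≥0} (htT : t ≤ T) {A B : Set ℝ}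
    (hA : MeasurableSet A) (hB : MeasurableSet B) :
    ∫⁻ x in A, condLaw P (timeReversal T (resetRBM ξ W N)) t x B ∂expMeasure (√r) =
      ∫⁻ y in B, forwardLaw P W N t y A ∂expMeasure (√r) := by
  have := isProbabilityMeasure_expMeasure_sqrt hr
  rw [h.forwardLaw_eq]
  exact setLIntegral_of_reversed (h.compProd_condDistrib hr hξ htT) hA hB

lemma Inputs.integral_semigroup_mul (hr : 0 < r) (h : Inputs P r ξ W N)
    (hξ : HasLaw ξ (expMeasure (√r)) P) {T t : ℝ≥0} (htT : t ≤ T) {f g : ℝ → ℝ}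
    (hf : MemLp f 2 (expMeasure (√r))) (hg : MemLp g 2 (expMeasure (√r))) :
    ∫ x, semigroup (forwardLaw P W N) t f x * g x ∂expMeasure (√r) =
      ∫ x, f x * semigroup (condLaw P (timeReversal T (resetRBM ξ W N))) t g x
        ∂expMeasure (√r) := by
  have := isProbabilityMeasure_expMeasure_sqrt hr
  rw [h.forwardLaw_eq]
  exact integral_mul_of_reversed (h.compProd_condDistrib hr hξ htT) hf hg

lemma BddMeas.memLp {α : Type*} [MeasurableSpace α] {μ : Measure α} [IsFiniteMeasure μ] {f : α → ℝ}
    (hf : BddMeas f) (p : ℝ≥0∞) : MemLp f p μ := by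
  obtain ⟨hm, C, hC⟩ := hf
  exact MemLp.of_bound hm.aestronglyMeasurable C (Eventually.of_forall hC)

/-- The generators of the process and of the reversed process are adjoint. -/
lemma Inputs.integral_generator_mul (hr : 0 < r) (h : Inputs P r ξ W N)
    (hξ : HasLaw ξ (expMeasure (√r)) P) {T : ℝ≥0} (hT : 0 < T) {f u g v : ℝ → ℝ}
    (hf : IsGenerator (expMeasure (√r)) (semigroup (forwardLaw P W N)) f u)
    (hg : IsGenerator (expMeasure (√r))
      (semigroup (condLaw P (timeReversal T (resetRBM ξ W N)))) g v) :
    ∫ x, u x * g x ∂expMeasure (√r) = ∫ x, f x * v x ∂expMeasure (√r) := by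
  have := isProbabilityMeasure_expMeasure_sqrt hr
  have hT' : ∀ᶠ t in 𝓝[>] (0 : ℝ≥0), t ≤ T :=
    nhdsWithin_le_nhds (Iic_mem_nhds hT)
  have h1 := hf.tendsto_integral_mul hg.1 (by
    filter_upwards [hT'] with t ht
    rw [h.forwardLaw_eq]
    exact ⟨aestronglyMeasurable_integral_of_reversed (h.compProd_condDistrib hr hξ ht) hf.1,
      integrable_integral_mul_of_reversed (h.compProd_condDistrib hr hξ ht) hf.1 hg.1⟩)
  have h2 := hg.tendsto_integral_mul hf.1 (by
    filter_upwards [hT'] with t ht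
    have hd : expMeasure (√r) ⊗ₘ h.absKernel t =
        (expMeasure (√r) ⊗ₘ condDistrib (timeReversal T (resetRBM ξ W N) t)
          (timeReversal T (resetRBM ξ W N) 0) P).map Prod.swap := by
      rw [h.compProd_condDistrib hr hξ ht, Measure.map_map measurable_swap measurable_swap,
        Prod.swap_swap_eq, Measure.map_id]
    exact ⟨aestronglyMeasurable_integral_of_reversed hd hg.1,
      integrable_integral_mul_of_reversed hd hg.1 hf.1⟩)
  have h3 := tendsto_nhds_unique (h1.congr' (by
    filter_upwards [hT'] with t ht
    rw [h.integral_semigroup_mul hr hξ ht hf.1 hg.1]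
    simp_rw [mul_comm])) h2
  rw [h3]
  simp_rw [mul_comm]

end

/-! ### Small-time expansion of the transition operators -/

section

/-- First-order Taylor bound for a function with Lipschitz derivative. -/
lemma abs_taylor_le {F d : ℝ → ℝ} {C : ℝ} (hF : ∀ z, HasDerivAt F (d z) z)
    (hd : ∀ z w, |d z - d w| ≤ C * |z - w|) (x u : ℝ) :
    |F (x + u) - F x - d x * u| ≤ C * u ^ 2 := by
  have hC : 0 ≤ C := by simpa using (abs_nonneg _).trans (hd 1 0)
  have hG : ∀ v ∈ uIcc 0 u, HasDerivWithinAt (fun v => F (x + v) - d x * v) (d (x + v) - d x)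
      (uIcc 0 u) v := fun v _ => by
    have h1 := ((hF (x + v)).comp_const_add x v).sub ((hasDerivAt_id v).const_mul (d x))
    exact (h1.congr_deriv (by simp)).hasDerivWithinAt
  have hb : ∀ v ∈ uIcc 0 u, ‖d (x + v) - d x‖ ≤ C * |u| := fun v hv => by
    refine (hd _ _).trans (mul_le_mul_of_nonneg_left ?_ hC)
    simpa using abs_sub_left_of_mem_uIcc hv
  have h := (convex_uIcc 0 u).norm_image_sub_le_of_norm_hasDerivWithin_le hG hb
    left_mem_uIcc right_mem_uIcc
  have e : F (x + u) - d x * u - (F (x + 0) - d x * 0) = F (x + u) - F x - d x * u := by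
    rw [add_zero]
    ring
  rw [e, sub_zero, Real.norm_eq_abs, Real.norm_eq_abs, mul_assoc, ← sq, sq_abs] at h
  exact h

/-- Second-order Taylor expansion at a point where the derivative is differentiable. -/
lemma tendsto_taylor {F d : ℝ → ℝ} (hF : ∀ z, HasDerivAt F (d z) z) {x a : ℝ}
    (ha : HasDerivAt d a x) :
    Tendsto (fun u => (F (x + u) - F x - d x * u) / u ^ 2) (𝓝[≠] 0) (𝓝 (a / 2)) := by
  rw [Metric.tendsto_nhds]
  intro ε hε
  have h1 := (Metric.tendsto_nhds.1 (hasDerivAt_iff_tendsto_slope_zero.1 ha)) (ε / 2)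
    (by positivity)
  rw [eventually_nhdsWithin_iff, Metric.eventually_nhds_iff] at h1
  obtain ⟨δ, hδ, h1⟩ := h1
  rw [eventually_nhdsWithin_iff, Metric.eventually_nhds_iff]
  refine ⟨δ, hδ, fun u hu hu0 => ?_⟩
  have hu0' : u ≠ 0 := hu0
  have hG : ∀ v ∈ uIcc 0 u, HasDerivWithinAt (fun v => F (x + v) - d x * v - a / 2 * v ^ 2)
      (d (x + v) - d x - a * v) (uIcc 0 u) v := fun v _ => by
    have h1 := (((hF (x + v)).comp_const_add x v).sub ((hasDerivAt_id v).const_mul (d x))).sub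
      ((hasDerivAt_pow 2 v).const_mul (a / 2))
    refine (h1.congr_deriv ?_).hasDerivWithinAt
    simp
    ring
  have hb : ∀ v ∈ uIcc 0 u, ‖d (x + v) - d x - a * v‖ ≤ ε / 2 * |u| := fun v hv => by
    have hvu : |v| ≤ |u| := by simpa using abs_sub_left_of_mem_uIcc hv
    rcases eq_or_ne v 0 with rfl | hv0
    · simpa using by positivity
    · have h2 := h1 (y := v) (by
        rw [Real.dist_eq, sub_zero] at hu ⊢
        exact hvu.trans_lt hu) hv0
      rw [Real.dist_eq] at h2
      have e : d (x + v) - d x - a * v = (v⁻¹ • (d (x + v) - d x) - a) * v := by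
        rw [smul_eq_mul]
        field_simp
      rw [e, norm_mul]
      exact mul_le_mul h2.le hvu (abs_nonneg _) (by positivity)
  have h := (convex_uIcc 0 u).norm_image_sub_le_of_norm_hasDerivWithin_le hG hb
    left_mem_uIcc right_mem_uIcc
  have e : (F (x + u) - F x - d x * u) / u ^ 2 - a / 2 =
      (F (x + u) - d x * u - a / 2 * u ^ 2 - (F (x + 0) - d x * 0 - a / 2 * 0 ^ 2)) / u ^ 2 := by
    rw [add_zero]
    field_simp
    ring
  rw [Real.dist_eq, e, abs_div, abs_of_nonneg (sq_nonneg u), div_lt_iff₀ (by positivity)]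
  refine h.trans_lt ?_
  rw [sub_zero, Real.norm_eq_abs, mul_assoc, ← sq, sq_abs]
  have : 0 < u ^ 2 := by positivity
  nlinarith

lemma integral_sq_gaussianReal (v : ℝ≥0) : ∫ g, g ^ 2 ∂gaussianReal 0 v = v := by
  have h := variance_of_integral_eq_zero (μ := gaussianReal 0 v) (X := id) aemeasurable_id
    integral_id_gaussianReal
  rw [variance_id_gaussianReal] at h
  simpa using h.symm

lemma integrable_sq_gaussianReal (v : ℝ≥0) : Integrable (fun g => g ^ 2) (gaussianReal 0 v) :=
  (memLp_id_gaussianReal' 2 (by simp)).integrable_sq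

lemma integrable_id_gaussianReal' (v : ℝ≥0) : Integrable (fun g => g) (gaussianReal 0 v) :=
  (memLp_id_gaussianReal' 1 (by simp)).integrable le_rfl

lemma tendsto_one_sub_cos_div (z : ℝ) {l : ℕ → ℝ} (h0 : ∀ m, l m ≠ 0)
    (hl : Tendsto l atTop (𝓝 0)) :
    Tendsto (fun m => (1 - Real.cos (l m * z)) / l m ^ 2) atTop (𝓝 (z ^ 2 / 2)) := by
  have h1 : HasDerivAt (fun l => Real.sin (l * (z / 2))) (z / 2) 0 := by
    have := (Real.hasDerivAt_sin (0 * (z / 2))).comp_of_eq 0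
      ((hasDerivAt_id 0).mul_const (z / 2)) rfl
    simpa [Function.comp_def] using this
  have h2 := (hasDerivAt_iff_tendsto_slope_zero.1 h1).comp
    (tendsto_nhdsWithin_iff.2 ⟨hl, Eventually.of_forall h0⟩)
  have h3 := (h2.pow 2).const_mul 2
  have e : 2 * (z / 2) ^ 2 = z ^ 2 / 2 := by ring
  rw [e] at h3
  refine h3.congr fun m => ?_
  have e1 : l m * z = 2 * (l m * (z / 2)) := by ring
  have e2 := Real.sin_sq_add_cos_sq (l m * (z / 2))
  rw [e1, Real.cos_two_mul, eq_sub_of_add_eq' e2]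
  simp only [Function.comp_apply, zero_add, zero_mul, Real.sin_zero, sub_zero, smul_eq_mul]
  rw [mul_pow, inv_pow]
  ring

section Gaussian

variable {F d : ℝ → ℝ} {C M : ℝ} (hF : ∀ z, HasDerivAt F (d z) z)
  (hd : ∀ z w, |d z - d w| ≤ C * |z - w|) (hM : ∀ z, |F z| ≤ M)

include hF hM in
/-- The first-order term does not contribute to the mean of a Gaussian perturbation. -/
lemma integral_gaussian_sub (x s : ℝ) : ∫ g, (F (x + s * g) - F x) ∂gaussianReal 0 1 =
    ∫ g, (F (x + s * g) - F x - d x * (s * g)) ∂gaussianReal 0 1 := by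
  have hc : Continuous F := continuous_iff_continuousAt.2 fun z => (hF z).continuousAt
  rw [integral_sub (f := fun g => F (x + s * g) - F x)]
  · rw [integral_const_mul, integral_const_mul, integral_id_gaussianReal]
    simp
  · refine Integrable.of_bound (C := M + M) (by fun_prop) (Eventually.of_forall fun g => ?_)
    exact (abs_sub _ _).trans (add_le_add (hM _) (hM _))
  · exact ((integrable_id_gaussianReal' 1).const_mul s).const_mul (d x)

include hF hd hM in
lemma abs_integral_gaussian_sub_le (x s : ℝ) :
    |∫ g, (F (x + s * g) - F x) ∂gaussianReal 0 1| ≤ C * s ^ 2 := by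
  rw [integral_gaussian_sub hF hM]
  have h1 := norm_integral_le_of_norm_le (μ := gaussianReal 0 1)
    (f := fun g => F (x + s * g) - F x - d x * (s * g))
    ((integrable_sq_gaussianReal 1).const_mul (C * s ^ 2)) (Eventually.of_forall fun g => by
      refine (abs_taylor_le hF hd x (s * g)).trans_eq ?_
      ring)
  rw [integral_const_mul, integral_sq_gaussianReal] at h1
  simpa using h1

include hF hd hM in
/-- The generator of `√2 W`. -/
lemma tendsto_integral_gaussian_sub_div {x a : ℝ} (ha : HasDerivAt d a x) :
    Tendsto (fun t : ℝ≥0 => (∫ g, (F (x + √(2 * t) * g) - F x) ∂gaussianReal 0 1) / t)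
      (𝓝[>] 0) (𝓝 a) := by
  have hc : Continuous F := continuous_iff_continuousAt.2 fun z => (hF z).continuousAt
  simp_rw [integral_gaussian_sub hF hM, ← integral_div]
  have ea : a = ∫ g, a * g ^ 2 ∂gaussianReal 0 1 := by
    rw [integral_const_mul, integral_sq_gaussianReal]
    simp
  rw [ea]
  have hsq : ∀ t : ℝ≥0, √(2 * (t : ℝ)) ^ 2 = 2 * t := fun t => Real.sq_sqrt (by positivity)
  refine tendsto_integral_filter_of_dominated_convergence (fun g => 2 * C * g ^ 2)
    (Eventually.of_forall fun t => by fun_prop) ?_ ((integrable_sq_gaussianReal 1).const_mul _)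
    (Eventually.of_forall fun g => ?_)
  · filter_upwards [self_mem_nhdsWithin] with t (ht : 0 < t)
    have ht' : (0 : ℝ) < t := ht
    refine Eventually.of_forall fun g => ?_
    rw [Real.norm_eq_abs, abs_div, abs_of_pos ht', div_le_iff₀ ht']
    refine (abs_taylor_le hF hd x _).trans_eq ?_
    rw [mul_pow, hsq]
    ring
  · rcases eq_or_ne g 0 with rfl | hg
    · simp
    have h1 : Tendsto (fun t : ℝ≥0 => √(2 * t) * g) (𝓝[>] 0) (𝓝[≠] 0) := by
      refine tendsto_nhdsWithin_iff.2 ⟨?_, ?_⟩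
      · have : Continuous fun t : ℝ≥0 => √(2 * t) * g := by fun_prop
        simpa using (this.tendsto 0).mono_left nhdsWithin_le_nhds
      · filter_upwards [self_mem_nhdsWithin] with t (ht : 0 < t)
        have ht' : (0 : ℝ) < t := ht
        have : √(2 * (t : ℝ)) ≠ 0 := (Real.sqrt_pos.2 (by positivity)).ne'
        exact mul_ne_zero this hg
    have h2 := ((tendsto_taylor hF ha).comp h1).mul_const (2 * g ^ 2)
    have e : a / 2 * (2 * g ^ 2) = a * g ^ 2 := by ring
    rw [e] at h2
    refine h2.congr' ?_
    filter_upwards [self_mem_nhdsWithin] with t (ht : 0 < t)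
    have ht' : (t : ℝ) ≠ 0 := ne_of_gt (NNReal.coe_pos.2 ht)
    simp only [Function.comp_apply]
    rw [mul_pow, hsq]
    field_simp

end Gaussian

section

variable {Ω : Type*} [MeasurableSpace Ω] {P : Measure Ω}
  {r : ℝ≥0} {ξ : Ω → ℝ} {W : ℝ≥0 → Ω → ℝ} {N : ℝ≥0 → Ω → ℕ}

lemma Inputs.measureReal_eq_zero (h : Inputs P r ξ W N) (t : ℝ≥0) :
    P.real {ω | N t ω = 0} = decay r 0 t := by
  rw [← tsub_zero t, ← h.measureReal_no_jump (zero_le (a := t)), tsub_zero]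
  refine measureReal_congr ?_
  filter_upwards [h.poisson.zero] with ω hω
  change (N t ω = 0) = (N t ω - N 0 ω = 0)
  rw [hω, tsub_zero]

lemma Inputs.measurableSet_no_jump (h : Inputs P r ξ W N) (t : ℝ≥0) :
    MeasurableSet {ω | N t ω = 0} :=
  h.measurable_poisson t (measurableSet_singleton 0)

/-- Before the first jump the process is `x + √2 W`, and `W` is independent of the jumps. -/
lemma Inputs.setIntegral_no_jump (h : Inputs P r ξ W N) (t : ℝ≥0) (x : ℝ) {G : ℝ → ℝ}
    (hG : Measurable G) :
    ∫ ω in {ω | N t ω = 0}, G (signedPath (fun _ => x) W N t ω) ∂P =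
      decay r 0 t * ∫ g, G (x + √(2 * t) * g) ∂gaussianReal 0 1 := by
  have hind : IndepFun (W t) (N t) P :=
    h.indep.comp (φ := fun w : ℝ≥0 → ℝ => w t) (ψ := fun n : ℝ≥0 → ℕ => n t)
      (by fun_prop) (by fun_prop)
  have hGx : Measurable fun w => G (x + √2 * w) := by fun_prop
  have h1 := hind.integral_fun_comp_mul_comp (h.measurable_brownian t).aemeasurable
    (h.measurable_poisson t).aemeasurable (f := fun w => G (x + √2 * w))
    (g := ({0} : Set ℕ).indicator fun _ => (1 : ℝ)) hGx.aestronglyMeasurable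
    (Measurable.of_discrete.aestronglyMeasurable)
  have h2 : ∫ ω, ({0} : Set ℕ).indicator (fun _ => (1 : ℝ)) (N t ω) ∂P = decay r 0 t := by
    rw [← h.measureReal_eq_zero, ← integral_indicator_one (h.measurableSet_no_jump t)]
    congr 1
  have h3 : ∫ ω, G (x + √2 * W t ω) ∂P = ∫ g, G (x + √(2 * t) * g) ∂gaussianReal 0 1 := by
    have e1 := (h.brownian.hasLaw_eval t).integral_comp (f := fun w => G (x + √2 * w))
      hGx.aestronglyMeasurable
    have e2 : gaussianReal 0 t = (gaussianReal 0 1).map (√t * ·) := by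
      rw [gaussianReal_map_const_mul]
      congr 1
      · simp
      · ext
        simp
    simp only [Function.comp_def] at e1
    rw [e1, e2, integral_map (by fun_prop) hGx.aestronglyMeasurable]
    simp_rw [Real.sqrt_mul zero_le_two, mul_assoc]
  rw [h2, h3] at h1
  rw [mul_comm, ← h1, ← integral_indicator (h.measurableSet_no_jump t)]
  refine integral_congr_ae ?_
  filter_upwards [h.poisson.zero, h.brownian.eval_zero_ae_eq_zero] with ω h0 hW0
  by_cases hω : N t ω = 0
  · have hz : signedPath (fun _ => x) W N t ω = x + √2 * W t ω := by
      simp [signedPath, resetPath, hω, lastJump_of_eq_zero (n := fun s => N s ω) h0 hω, hW0]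
    simp [indicator, hω, hz]
  · simp [indicator, hω]

variable [IsProbabilityMeasure P] [P.IsComplete]

/-- The second moment of the process started at `0` is at most that of `√2 W`: by Fatou's lemma it
is at most the lower limit of `2 (1 - Re φ(l)) / l ^ 2` as `l → 0`, where `φ` is the
characteristic function. -/
lemma Inputs.lintegral_sq_signedPath_le (hr : 0 < r) (h : Inputs P r ξ W N) (t : ℝ≥0) :
    ∫⁻ ω, ENNReal.ofReal (signedPath (fun _ => 0) W N t ω ^ 2 / 2) ∂P ≤ t := by
  have hm := (h.const 0).measurable_signedPath t
  set Z := signedPath (fun _ => 0) W N t with hZ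
  let l : ℕ → ℝ := fun m => ((m : ℝ) + 1)⁻¹
  have hl0 : ∀ m, l m ≠ 0 := fun m => by positivity
  have hl : Tendsto l atTop (𝓝 0) := by
    simpa only [l, one_div] using tendsto_one_div_add_atTop_nhds_zero_nat (𝕜 := ℝ)
  have hb : ∀ m, ∫⁻ ω, ENNReal.ofReal ((1 - Real.cos (l m * Z ω)) / l m ^ 2) ∂P ≤ t := by
    intro m
    have hci : Integrable (fun ω => Real.cos (l m * Z ω)) P :=
      Integrable.of_bound (by fun_prop) 1 (Eventually.of_forall fun ω => Real.abs_cos_le_one _)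
    have hdi : Integrable (fun ω => (1 - Real.cos (l m * Z ω)) / l m ^ 2) P :=
      ((integrable_const 1).sub hci).div_const _
    rw [← ofReal_integral_eq_lintegral_ofReal hdi
      (Eventually.of_forall fun ω => div_nonneg (sub_nonneg.2 (Real.cos_le_one _)) (sq_nonneg _)),
      integral_div]
    have hcos : ∫ ω, Real.cos (l m * Z ω) ∂P =
        decay r (l m) t + r / (r + l m ^ 2) * (1 - decay r (l m) t) := by
      have h1 := h.charFun_signedKernel hr t 0 (l m)
      rw [charFun_apply_real, h.signedKernel_apply, integral_map hm.aemeasurable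
        (by fun_prop)] at h1
      have h2 : Integrable (fun ω => Complex.exp (l m * Z ω * Complex.I)) P :=
        Integrable.of_bound (by fun_prop) 1 (Eventually.of_forall fun ω => by
          rw [← Complex.ofReal_mul, Complex.norm_exp_ofReal_mul_I])
      have h3 := integral_re h2
      rw [h1] at h3
      simp only [← Complex.ofReal_mul, RCLike.re_to_complex, Complex.exp_ofReal_mul_I_re] at h3
      rw [h3, mul_zero, Complex.ofReal_zero, zero_mul, Complex.exp_zero, mul_one,
        ← Complex.ofReal_add, Complex.ofReal_re]
    rw [integral_sub (integrable_const 1) hci, hcos]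
    refine ENNReal.ofReal_le_of_le_toReal ?_
    have hr' : (0 : ℝ) < r := hr
    have hq : 0 < l m ^ 2 := by have := hl0 m; positivity
    have hdec : 1 - decay r (l m) t ≤ (r + l m ^ 2) * t := by
      have := Real.add_one_le_exp (-((r + l m ^ 2) * t))
      rw [decay]
      linarith
    rw [div_le_iff₀ hq]
    simp only [integral_const, probReal_univ, one_smul, ENNReal.coe_toReal]
    calc 1 - (decay r (l m) t + r / (r + l m ^ 2) * (1 - decay r (l m) t))
        = l m ^ 2 / (r + l m ^ 2) * (1 - decay r (l m) t) := by
          field_simp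
          ring
      _ ≤ l m ^ 2 / (r + l m ^ 2) * ((r + l m ^ 2) * t) := by gcongr
      _ = t * l m ^ 2 := by field_simp
  calc ∫⁻ ω, ENNReal.ofReal (Z ω ^ 2 / 2) ∂P
      = ∫⁻ ω, liminf (fun m => ENNReal.ofReal ((1 - Real.cos (l m * Z ω)) / l m ^ 2)) atTop ∂P :=
        lintegral_congr fun ω =>
          (((ENNReal.continuous_ofReal.tendsto _).comp
            (tendsto_one_sub_cos_div (Z ω) hl0 hl)).liminf_eq).symm
    _ ≤ liminf (fun m => ∫⁻ ω, ENNReal.ofReal ((1 - Real.cos (l m * Z ω)) / l m ^ 2) ∂P) atTop :=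
        lintegral_liminf_le fun m => by fun_prop
    _ ≤ t := by
        refine (liminf_le_liminf (Eventually.of_forall hb)).trans_eq ?_
        simp

lemma Inputs.integrable_sq_signedPath (hr : 0 < r) (h : Inputs P r ξ W N) (t : ℝ≥0) :
    Integrable (fun ω => signedPath (fun _ => 0) W N t ω ^ 2) P := by
  have hm := (h.const 0).measurable_signedPath t
  have : Integrable (fun ω => signedPath (fun _ => 0) W N t ω ^ 2 / 2) P := by
    refine ⟨by fun_prop, ?_⟩
    rw [hasFiniteIntegral_iff_ofReal (Eventually.of_forall fun ω => by positivity)]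
    exact (h.lintegral_sq_signedPath_le hr t).trans_lt ENNReal.coe_lt_top
  refine (this.const_mul 2).congr (Eventually.of_forall fun ω => ?_)
  ring

/-- As the second moment of the process is at most `2 t`, of which `2 t e ^ (-r t)` come from the
paths without a jump, the paths with a jump contribute `O(t ^ 2)`. -/
lemma Inputs.setIntegral_sq_signedPath_le (hr : 0 < r) (h : Inputs P r ξ W N) (t : ℝ≥0) :
    ∫ ω in {ω | N t ω = 0}ᶜ, signedPath (fun _ => 0) W N t ω ^ 2 ∂P ≤
      2 * t * (1 - decay r 0 t) := by
  have hi := h.integrable_sq_signedPath hr t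
  have h1 : ∫ ω, signedPath (fun _ => 0) W N t ω ^ 2 / 2 ∂P ≤ (t : ℝ) := by
    rw [integral_eq_lintegral_of_nonneg_ae (Eventually.of_forall fun ω => by positivity)
      (hi.div_const 2).1]
    exact ENNReal.toReal_mono ENNReal.coe_ne_top (h.lintegral_sq_signedPath_le hr t)
  have h2 := h.setIntegral_no_jump t 0 (G := fun z => z ^ 2) (by fun_prop)
  have h3 : ∫ g, (0 + √(2 * t) * g) ^ 2 ∂gaussianReal 0 1 = 2 * (t : ℝ) := by
    simp_rw [zero_add, mul_pow]
    rw [integral_const_mul, integral_sq_gaussianReal, Real.sq_sqrt (by positivity)]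
    simp
  rw [h3] at h2
  have h4 := integral_add_compl (h.measurableSet_no_jump t) hi
  rw [integral_div] at h1
  rw [h2] at h4
  linarith

/-- The expectation is split according to whether there is a jump; after a jump, the process is
close to `0`. -/
lemma Inputs.abs_integral_sub_le (hr : 0 < r) (h : Inputs P r ξ W N) (t : ℝ≥0) (x : ℝ) {G : ℝ → ℝ}
    (hG : Measurable G) {M D : ℝ} (hM : ∀ z, |G z| ≤ M) (hD : ∀ z, |G z - G 0| ≤ D * z ^ 2) :
    |∫ ω, G (signedPath (fun _ => x) W N t ω) ∂P - G x -
        (decay r 0 t * ∫ g, (G (x + √(2 * t) * g) - G x) ∂gaussianReal 0 1 +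
          (1 - decay r 0 t) * (G 0 - G x))| ≤ D * (2 * t * (1 - decay r 0 t)) := by
  have hm := (h.const x).measurable_signedPath t
  have hm0 := (h.const 0).measurable_signedPath t
  have hD0 : 0 ≤ D := by simpa using (abs_nonneg _).trans (hD 1)
  have hS := h.measurableSet_no_jump t
  have hi : Integrable (fun ω => G (signedPath (fun _ => x) W N t ω)) P :=
    Integrable.of_bound (hG.comp hm).aestronglyMeasurable M (Eventually.of_forall fun ω => hM _)
  have hi0 : Integrable (fun ω => G (signedPath (fun _ => 0) W N t ω)) P :=
    Integrable.of_bound (hG.comp hm0).aestronglyMeasurable M (Eventually.of_forall fun ω => hM _)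
  have hj : ∫ ω in {ω | N t ω = 0}ᶜ, G (signedPath (fun _ => x) W N t ω) ∂P =
      ∫ ω in {ω | N t ω = 0}ᶜ, (G (signedPath (fun _ => 0) W N t ω) - G 0) ∂P +
        (1 - decay r 0 t) * G 0 := by
    rw [integral_sub hi0.integrableOn (integrable_const _), setIntegral_const,
      probReal_compl_eq_one_sub hS, h.measureReal_eq_zero, smul_eq_mul, sub_add_cancel]
    refine setIntegral_congr_fun hS.compl fun ω hω => ?_
    have hω' : N t ω ≠ 0 := hω
    rw [signedPath_eq_add, if_neg hω', zero_add]
  have hg : ∫ g, (G (x + √(2 * t) * g) - G x) ∂gaussianReal 0 1 =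
      ∫ g, G (x + √(2 * t) * g) ∂gaussianReal 0 1 - G x := by
    rw [integral_sub _ (integrable_const _)]
    · simp
    · exact Integrable.of_bound (hG.comp (by fun_prop)).aestronglyMeasurable M
        (Eventually.of_forall fun ω => hM _)
  have e : ∫ ω, G (signedPath (fun _ => x) W N t ω) ∂P - G x -
        (decay r 0 t * ∫ g, (G (x + √(2 * t) * g) - G x) ∂gaussianReal 0 1 +
          (1 - decay r 0 t) * (G 0 - G x)) =
      ∫ ω in {ω | N t ω = 0}ᶜ, (G (signedPath (fun _ => 0) W N t ω) - G 0) ∂P := by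
    rw [← integral_add_compl hS hi, hj, h.setIntegral_no_jump t x hG, hg]
    ring
  rw [e]
  refine (norm_integral_le_of_norm_le
    (f := fun ω => G (signedPath (fun _ => 0) W N t ω) - G 0)
    ((h.integrable_sq_signedPath hr t).const_mul D).integrableOn
    (Eventually.of_forall fun ω => hD _)).trans ?_
  rw [integral_const_mul]
  exact mul_le_mul_of_nonneg_left (h.setIntegral_sq_signedPath_le hr t) hD0

end

end

/-! ### The generator on its explicit domain -/

section

/-- The even extension `z ↦ f |z|` of a function in the domain has a Lipschitz derivative
`d`, the Neumann condition making the extension differentiable at `0`. -/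
lemma DomA.exists_hasDerivAt {f : ℝ → ℝ} (hf : DomA f) : ∃ (d : ℝ → ℝ) (C : ℝ),
    (∀ z, HasDerivAt (fun z => f |z|) (d z) z) ∧ d 0 = 0 ∧ (∀ z w, |d z - d w| ≤ C * |z - w|) ∧
      ∀ x, 0 < x → HasDerivAt d (deriv (deriv f) x) x := by
  obtain ⟨C, hC⟩ := hf.bdd₂
  have hC0 : 0 ≤ C := (abs_nonneg _).trans (hC 1 one_pos)
  have h2 := (contDiffOn_succ_iff_deriv_of_isOpen (n := 1) isOpen_Ioi).1
    (by simpa [one_add_one_eq_two] using hf.smooth)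
  have hfd : ∀ x, 0 < x → HasDerivAt f (deriv f x) x := fun x hx =>
    (h2.1.differentiableAt (Ioi_mem_nhds hx)).hasDerivAt
  have hfdd : ∀ x, 0 < x → HasDerivAt (deriv f) (deriv (deriv f) x) x := fun x hx =>
    ((h2.2.2.differentiableOn (by simp)).differentiableAt (Ioi_mem_nhds hx)).hasDerivAt
  have hlip : ∀ x y, 0 < x → 0 < y → |deriv f x - deriv f y| ≤ C * |x - y| := fun x y hx hy =>
    (convex_Ioi (0 : ℝ)).norm_image_sub_le_of_norm_hasDerivWithin_le
      (fun z hz => (hfdd z hz).hasDerivWithinAt) (fun z hz => hC z hz) hy hx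
  -- compare with a point near `0`, where `f'` is a difference quotient of `f` at `0`
  have hlin : ∀ x, 0 < x → |deriv f x| ≤ C * x := by
    intro x hx
    have hs := hasDerivWithinAt_iff_tendsto_slope.1 hf.neumann
    rw [Ici_sdiff_left] at hs
    have hs' := hs.abs.const_add (C * x)
    rw [abs_zero, add_zero] at hs'
    refine ge_of_tendsto hs' ?_
    filter_upwards [Ioo_mem_nhdsGT hx] with δ hδ
    obtain ⟨y, hy, hyd⟩ := exists_deriv_eq_slope f hδ.1 (hf.cont.mono Icc_subset_Ici_self)
      (fun z hz => (hfd z hz.1).differentiableAt.differentiableWithinAt)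
    have e : slope f 0 δ = deriv f y := by rw [hyd, slope_def_field]
    have h3 := hlip x y hx hy.1
    have h4 : |x - y| ≤ x := abs_le.2 ⟨by linarith [hy.2, hδ.2], by linarith [hy.1]⟩
    have h5 := mul_le_mul_of_nonneg_left h4 hC0
    have h6 := abs_sub_abs_le_abs_sub (deriv f x) (deriv f y)
    rw [e]
    linarith
  -- the odd extension of `f'` is `z ↦ e z - e (-z)`
  let e : ℝ → ℝ := fun x => if 0 < x then deriv f x else 0
  have he : ∀ x y, |e x - e y| ≤ C * |x - y| := by
    intro x y
    by_cases hx : 0 < x <;> by_cases hy : 0 < y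
    · simpa [e, hx, hy] using hlip x y hx hy
    · have h3 := hlin x hx
      have h4 : x ≤ |x - y| := le_abs.2 (Or.inl (by linarith))
      simpa [e, hx, hy] using h3.trans (mul_le_mul_of_nonneg_left h4 hC0)
    · have h3 := hlin y hy
      have h4 : y ≤ |x - y| := le_abs.2 (Or.inr (by linarith))
      simpa [e, hx, hy] using h3.trans (mul_le_mul_of_nonneg_left h4 hC0)
    · simpa [e, hx, hy] using by positivity
  refine ⟨fun z => e z - e (-z), 2 * C, fun z => ?_, by simp, fun z w => ?_, fun x hx => ?_⟩
  · rcases lt_trichotomy z 0 with hz | rfl | hz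
    · have h3 := (hfd (-z) (neg_pos.2 hz)).comp z (hasDerivAt_neg z)
      have h4 : (fun z => f |z|) =ᶠ[𝓝 z] f ∘ fun z => -z := by
        filter_upwards [Iio_mem_nhds hz] with w (hw : w < 0)
        simp [abs_of_neg hw]
      refine (h3.congr_of_eventuallyEq h4).congr_deriv ?_
      simp [e, hz, not_lt.2 hz.le]
    · have h3 : HasDerivWithinAt (fun z => f |z|) 0 (Ici 0) 0 :=
        hf.neumann.congr (fun z hz => by rw [abs_of_nonneg hz]) (by simp)
      have h4 : HasDerivWithinAt (fun z => f |z|) 0 (Iic 0) 0 := by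
        have h5 : HasDerivWithinAt f 0 (Ici 0) (-0) := by simpa using hf.neumann
        have h6 := h5.scomp (0 : ℝ) (s := Iic 0) (hasDerivWithinAt_neg 0 _)
          (fun z hz => by simpa using hz)
        refine (h6.congr (fun z (hz : z ≤ 0) => ?_) (by simp)).congr_deriv (by simp)
        simp [abs_of_nonpos hz]
      have h5 := h4.union h3
      rw [Iic_union_Ici, hasDerivWithinAt_univ] at h5
      simpa using h5
    · have h4 : (fun z => f |z|) =ᶠ[𝓝 z] f := by
        filter_upwards [Ioi_mem_nhds hz] with w hw
        rw [abs_of_pos hw]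
      refine ((hfd z hz).congr_of_eventuallyEq h4).congr_deriv ?_
      simp [e, hz, not_lt.2 hz.le]
  · have h3 := he z w
    have h4 := he (-z) (-w)
    have h5 : |-z - -w| = |z - w| := by rw [← abs_neg]; congr 1; ring
    rw [h5] at h4
    calc |e z - e (-z) - (e w - e (-w))| = |(e z - e w) - (e (-z) - e (-w))| := by
          congr 1; ring
      _ ≤ |e z - e w| + |e (-z) - e (-w)| := abs_sub _ _
      _ ≤ 2 * C * |z - w| := by linarith
  · refine (hfdd x hx).congr_of_eventuallyEq ?_
    filter_upwards [Ioi_mem_nhds hx] with w (hw : 0 < w)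
    simp [e, hw, not_lt.2 hw.le]

lemma tendsto_eLpNorm_two_of_bounded {α ι : Type*} [MeasurableSpace α] {μ : Measure α}
    [IsFiniteMeasure μ] {l : Filter ι} [l.IsCountablyGenerated] {q : ι → α → ℝ} {K : ℝ}
    (hm : ∀ᶠ n in l, AEStronglyMeasurable (q n) μ) (hK : ∀ᶠ n in l, ∀ᵐ x ∂μ, |q n x| ≤ K)
    (hq : ∀ᵐ x ∂μ, Tendsto (fun n => q n x) l (𝓝 0)) :
    Tendsto (fun n => eLpNorm (q n) 2 μ) l (𝓝 0) := by
  simp_rw [eLpNorm_eq_lintegral_rpow_enorm_toReal two_ne_zero ENNReal.ofNat_ne_top]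
  have h := tendsto_lintegral_filter_of_dominated_convergence' (l := l) (μ := μ)
    (F := fun n x => ‖q n x‖ₑ ^ (2 : ℝ≥0∞).toReal) (f := fun _ => 0)
    (fun _ => ENNReal.ofReal K ^ (2 : ℝ≥0∞).toReal)
    (hm.mono fun n hn => hn.enorm.pow_const _)
    (hK.mono fun n hn => hn.mono fun x hx => by
      gcongr
      rw [← ofReal_norm]
      exact ENNReal.ofReal_le_ofReal hx)
    (by
      rw [lintegral_const]
      exact ENNReal.mul_ne_top (by simp) (measure_ne_top _ _))
    (hq.mono fun x hx => by
      have h1 := ((ENNReal.continuous_rpow_const (y := (2 : ℝ≥0∞).toReal)).tendsto _).comp hx.enorm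
      simpa [Function.comp_def] using h1)
  have h2 := ((ENNReal.continuous_rpow_const (y := 1 / (2 : ℝ≥0∞).toReal)).tendsto _).comp h
  simpa [Function.comp_def] using h2

lemma tendsto_one_sub_decay_div (r : ℝ≥0) :
    Tendsto (fun t : ℝ≥0 => (1 - decay r 0 t) / t) (𝓝[>] 0) (𝓝 (r : ℝ)) := by
  have h1 : HasDerivAt (fun s : ℝ => -Real.exp (-(r * s))) (r : ℝ) 0 := by
    have h0 : HasDerivAt (fun s : ℝ => -((r : ℝ) * s)) (-(r : ℝ)) 0 := by
      exact ((hasDerivAt_id (0 : ℝ)).const_mul (r : ℝ)).neg.congr_deriv (by simp)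
    exact h0.exp.neg.congr_deriv (by simp)
  have h2 : Tendsto (fun t : ℝ≥0 => (t : ℝ)) (𝓝[>] 0) (𝓝[≠] 0) := by
    refine tendsto_nhdsWithin_iff.2
      ⟨(NNReal.continuous_coe.tendsto 0).mono_left nhdsWithin_le_nhds, ?_⟩
    filter_upwards [self_mem_nhdsWithin] with t (ht : 0 < t)
    exact ne_of_gt (NNReal.coe_pos.2 ht)
  refine ((hasDerivAt_iff_tendsto_slope_zero.1 h1).comp h2).congr fun t => ?_
  simp only [Function.comp_apply, decay, smul_eq_mul, zero_add, mul_zero, neg_zero, Real.exp_zero,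
    ne_eq, OfNat.ofNat_ne_zero, not_false_eq_true, zero_pow, add_zero]
  ring

section

variable {Ω : Type*} [MeasurableSpace Ω] {P : Measure Ω} [IsProbabilityMeasure P] [P.IsComplete]
  {r : ℝ≥0} {ξ : Ω → ℝ} {W : ℝ≥0 → Ω → ℝ} {N : ℝ≥0 → Ω → ℕ}

lemma Inputs.semigroup_forwardLaw (h : Inputs P r ξ W N) {f : ℝ → ℝ}
    (hf : Measurable fun z => f |z|) (t : ℝ≥0) (x : ℝ) :
    semigroup (forwardLaw P W N) t f x = ∫ ω, f |signedPath (fun _ => x) W N t ω| ∂P := by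
  have hm := (h.const x).measurable_resetRBM t
  have h0 : ∀ᵐ z ∂forwardLaw P W N t x, 0 ≤ z :=
    (ae_map_iff hm.aemeasurable measurableSet_Ici).2 (Eventually.of_forall fun ω => abs_nonneg _)
  have h1 : f =ᵐ[forwardLaw P W N t x] fun z => f |z| :=
    h0.mono fun z hz => by simp [abs_of_nonneg hz]
  rw [semigroup, integral_congr_ae h1, forwardLaw, integral_map hm.aemeasurable
    hf.aestronglyMeasurable]
  simp_rw [resetRBM_eq, abs_abs]

lemma one_sub_decay_nonneg (r : ℝ≥0) (t : ℝ≥0) : 0 ≤ 1 - decay r 0 t := by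
  rw [decay, sub_nonneg, Real.exp_le_one_iff, neg_nonpos]
  positivity

lemma one_sub_decay_le (r : ℝ≥0) (t : ℝ≥0) : 1 - decay r 0 t ≤ r * t := by
  have := Real.add_one_le_exp (-((r : ℝ) * t))
  simp only [decay, ne_eq, OfNat.ofNat_ne_zero, not_false_eq_true, zero_pow, add_zero]
  linarith

/-- Functions in the explicit domain are in the domain of the `L²`-generator: the difference
quotients are uniformly bounded and converge pointwise on `(0, ∞)`. -/
lemma Inputs.isGenerator_opA (hr : 0 < r) (h : Inputs P r ξ W N) {f : ℝ → ℝ} (hf : DomA f) :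
    IsGenerator (expMeasure (√r)) (semigroup (forwardLaw P W N)) f (opA r f) := by
  have := isProbabilityMeasure_expMeasure_sqrt hr
  have hpos := ae_expMeasure_pos (√(r : ℝ))
  obtain ⟨d, D, hF, hd0, hd, hdd⟩ := hf.exists_hasDerivAt
  obtain ⟨M, hM⟩ := hf.bdd
  obtain ⟨C, hC⟩ := hf.bdd₂
  set F : ℝ → ℝ := fun z => f |z| with hFdef
  have hFc : Continuous F := continuous_iff_continuousAt.2 fun z => (hF z).continuousAt
  have hFM : ∀ z, |F z| ≤ M := fun z => hM _ (abs_nonneg z)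
  have hF0 : F 0 = f 0 := by simp [F]
  have hFx : ∀ x, 0 < x → F x = f x := fun x hx => by simp [F, abs_of_pos hx]
  have hfF : f =ᵐ[expMeasure (√(r : ℝ))] F := hpos.mono fun x hx => (hFx x hx).symm
  have hfm : AEStronglyMeasurable f (expMeasure (√(r : ℝ))) :=
    hFc.aestronglyMeasurable.congr hfF.symm
  have hAm : AEStronglyMeasurable (opA r f) (expMeasure (√(r : ℝ))) :=
    (measurable_deriv (deriv f)).aestronglyMeasurable.add
      ((aestronglyMeasurable_const.sub hfm).const_mul _)
  have hD : ∀ z, |F z - F 0| ≤ D * z ^ 2 := fun z => by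
    simpa [hd0] using abs_taylor_le hF hd 0 z
  have hD0 : 0 ≤ D := by simpa using (abs_nonneg _).trans (hD 1)
  have hfb : ∀ x, 0 < x → |f 0 - f x| ≤ M + M := fun x hx =>
    (abs_sub _ _).trans (add_le_add (hM 0 le_rfl) (hM x hx.le))
  have hM0 : 0 ≤ M := (abs_nonneg _).trans (hM 0 le_rfl)
  have hAb : ∀ x, 0 < x → |opA r f x| ≤ C + r * (M + M) := fun x hx => by
    refine (abs_add_le _ _).trans (add_le_add (hC x hx) ?_)
    rw [abs_mul, abs_of_nonneg r.coe_nonneg]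
    exact mul_le_mul_of_nonneg_left (hfb x hx) r.coe_nonneg
  -- `I t x` is the increment of the mean value of `F` along `√2 W`
  set I : ℝ≥0 → ℝ → ℝ := fun t x => ∫ g, (F (x + √(2 * t) * g) - F x) ∂gaussianReal 0 1 with hI
  have hIb : ∀ t x, |I t x| ≤ D * (2 * t) := fun t x => by
    have := abs_integral_gaussian_sub_le hF hd hFM x (√(2 * t))
    rwa [Real.sq_sqrt (by positivity)] at this
  have hS : ∀ t x, semigroup (forwardLaw P W N) t f x =
      ∫ ω, F (signedPath (fun _ => x) W N t ω) ∂P := h.semigroup_forwardLaw hFc.measurable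
  have key : ∀ t x, 0 < x → |semigroup (forwardLaw P W N) t f x - f x -
      (decay r 0 t * I t x + (1 - decay r 0 t) * (f 0 - f x))| ≤
        D * (2 * t * (1 - decay r 0 t)) := fun t x hx => by
    rw [hS, ← hFx x hx, ← hF0]
    exact h.abs_integral_sub_le hr t x hFc.measurable hFM hD
  have hSm : ∀ t, Measurable (semigroup (forwardLaw P W N) t f) := fun t => by
    have e : semigroup (forwardLaw P W N) t f = fun x => ∫ z, F z ∂h.signedKernel t x := by
      ext x
      rw [hS, h.signedKernel_apply, integral_map ((h.const x).measurable_signedPath t).aemeasurable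
        hFc.aestronglyMeasurable]
    rw [e]
    exact hFc.stronglyMeasurable.integral_kernel.measurable
  refine ⟨MemLp.of_bound hfm M (hpos.mono fun x hx => hM x hx.le),
    MemLp.of_bound hAm (C + r * (M + M)) (hpos.mono hAb),
    tendsto_eLpNorm_two_of_bounded
      (K := D * 2 + r * (M + M) + D * (2 * 1) + (C + r * (M + M))) ?_ ?_ ?_⟩
  · exact Eventually.of_forall fun t =>
      (((hSm t).aestronglyMeasurable.sub hfm).div₀ aestronglyMeasurable_const).sub hAm
  · filter_upwards [self_mem_nhdsWithin] with t (ht : 0 < t)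
    have ht' : (0 : ℝ) < t := ht
    filter_upwards [hpos] with x hx
    refine (abs_sub _ _).trans (add_le_add ?_ (hAb x hx))
    rw [abs_div, abs_of_pos ht', div_le_iff₀ ht']
    have h1 := one_sub_decay_nonneg r t
    have h2 : 1 - decay r 0 t ≤ 1 := by linarith [decay_nonneg r 0 t]
    have h3 : |decay r 0 t * I t x| ≤ D * (2 * t) := by
      rw [abs_mul, abs_of_nonneg (decay_nonneg r 0 t)]
      exact (mul_le_of_le_one_left (abs_nonneg _) (by linarith)).trans (hIb t x)
    have h4 : |(1 - decay r 0 t) * (f 0 - f x)| ≤ r * t * (M + M) := by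
      rw [abs_mul, abs_of_nonneg h1]
      exact mul_le_mul (one_sub_decay_le r t) (hfb x hx) (abs_nonneg _) (by positivity)
    have h5 : D * (2 * t * (1 - decay r 0 t)) ≤ D * (2 * t * 1) := by gcongr
    have h6 := key t x hx
    have h7 := abs_sub_abs_le_abs_sub (semigroup (forwardLaw P W N) t f x - f x)
      (decay r 0 t * I t x + (1 - decay r 0 t) * (f 0 - f x))
    have h8 := abs_add_le (decay r 0 t * I t x) ((1 - decay r 0 t) * (f 0 - f x))
    nlinarith
  · filter_upwards [hpos] with x hx
    have h1 := tendsto_integral_gaussian_sub_div hF hd hFM (hdd x hx)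
    have h2 := tendsto_one_sub_decay_div r
    have hid : Tendsto (fun t : ℝ≥0 => (t : ℝ)) (𝓝[>] 0) (𝓝 0) :=
      (NNReal.continuous_coe.tendsto 0).mono_left nhdsWithin_le_nhds
    have h3 : Tendsto (fun t : ℝ≥0 => 1 - decay r 0 t) (𝓝[>] 0) (𝓝 0) := by
      have : Continuous fun t : ℝ≥0 => 1 - decay r 0 t := by unfold decay; fun_prop
      simpa [decay] using (this.tendsto 0).mono_left nhdsWithin_le_nhds
    have h4 := h3.const_sub 1
    simp only [sub_sub_cancel, sub_zero] at h4
    have h5 := (h4.mul h1).add (h2.mul_const (f 0 - f x))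
    rw [one_mul] at h5
    have h6 : Tendsto (fun t : ℝ≥0 => (semigroup (forwardLaw P W N) t f x - f x) / t -
        (decay r 0 t * (I t x / t) + (1 - decay r 0 t) / t * (f 0 - f x))) (𝓝[>] 0) (𝓝 0) := by
      have h7 := (h3.const_mul (2 * D))
      rw [mul_zero] at h7
      refine squeeze_zero_norm' ?_ h7
      filter_upwards [self_mem_nhdsWithin] with t (ht : 0 < t)
      have ht' : (0 : ℝ) < t := ht
      have e : (semigroup (forwardLaw P W N) t f x - f x) / t -
          (decay r 0 t * (I t x / t) + (1 - decay r 0 t) / t * (f 0 - f x)) =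
          (semigroup (forwardLaw P W N) t f x - f x -
            (decay r 0 t * I t x + (1 - decay r 0 t) * (f 0 - f x))) / t := by
        ring
      rw [e, Real.norm_eq_abs, abs_div, abs_of_pos ht', div_le_iff₀ ht']
      exact (key t x hx).trans_eq (by ring)
    have h7 := (h6.add h5).sub_const (opA r f x)
    have e : 0 + (deriv (deriv f) x + r * (f 0 - f x)) - opA r f x = 0 := by
      rw [opA]
      ring
    rw [e] at h7
    refine h7.congr fun t => ?_
    rw [sub_add_cancel]

end

end

/-! ### Passage to the completed probability space -/

section

variable {Ω : Type*} [MeasurableSpace Ω] {P : Measure Ω}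

/-- The identity map from the completed probability space. -/
def fromCompletion (P : Measure Ω) : NullMeasurableSpace Ω P → Ω := fun ω => ω

lemma measurePreserving_fromCompletion (P : Measure Ω) :
    MeasurePreserving (fromCompletion P) P.completion P := by
  have hm : Measurable (fromCompletion P) := fun s hs => hs.nullMeasurableSet
  exact ⟨hm, Measure.ext fun s hs => Measure.map_apply hm hs⟩

instance [IsFiniteMeasure P] : IsFiniteMeasure P.completion :=
  ⟨measure_lt_top P univ⟩

instance [IsProbabilityMeasure P] : IsProbabilityMeasure P.completion :=
  ⟨measure_univ (μ := P)⟩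

lemma HasLaw.completion {β : Type*} [MeasurableSpace β] {X : Ω → β} {ν : Measure β}
    (h : HasLaw X ν P) : HasLaw (Ω := NullMeasurableSpace Ω P) X ν P.completion :=
  h.comp ⟨(measurePreserving_fromCompletion P).aemeasurable,
    (measurePreserving_fromCompletion P).map_eq⟩

lemma map_completion {β : Type*} [MeasurableSpace β] [MeasurableSpace.CountablyGenerated β]
    {X : NullMeasurableSpace Ω P → β} (hX : Measurable X) :
    P.completion.map X = Measure.map (α := Ω) X P := by
  have hX' : AEMeasurable (α := Ω) X P := NullMeasurable.aemeasurable hX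
  refine Measure.ext fun s hs => ?_
  rw [Measure.map_apply hX hs, Measure.map_apply_of_aemeasurable hX' hs]
  rfl

lemma condDistrib_completion [IsFiniteMeasure P] {X Y : NullMeasurableSpace Ω P → ℝ}
    (hX : Measurable X) (hY : Measurable Y) :
    condDistrib Y X P.completion = condDistrib (α := Ω) Y X P := by
  refine (condDistrib_def Y X P.completion).trans
    (Eq.trans ?_ (condDistrib_def (α := Ω) Y X P).symm)
  congr 1
  exact map_completion (hX.prodMk hY)

lemma integral_completion {f : NullMeasurableSpace Ω P → ℝ} (hf : Measurable f) :
    ∫ ω, f ω ∂P.completion = ∫ ω, f ω ∂P := by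
  have hf' : AEMeasurable (α := Ω) f P := NullMeasurable.aemeasurable hf
  have h := integral_map (μ := P.completion) (measurePreserving_fromCompletion P).aemeasurable
    (f := (f : Ω → ℝ)) (by
      rw [(measurePreserving_fromCompletion P).map_eq]
      exact hf'.aestronglyMeasurable)
  rw [(measurePreserving_fromCompletion P).map_eq] at h
  exact h.symm

lemma IndepFun.completion {β γ : Type*} [MeasurableSpace β] [MeasurableSpace γ] {X : Ω → β}
    {Y : Ω → γ} (h : IndepFun X Y P) :
    IndepFun (Ω := NullMeasurableSpace Ω P) X Y P.completion :=
  indepFun_iff_measure_inter_preimage_eq_mul.2 fun _ _ hs ht =>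
    h.measure_inter_preimage_eq_mul _ _ hs ht

lemma iIndepFun.completion {ι : Type*} {β : ι → Type*} [∀ i, MeasurableSpace (β i)]
    {X : ∀ i, Ω → β i} (h : iIndepFun X P) :
    iIndepFun (Ω := NullMeasurableSpace Ω P) X P.completion :=
  iIndepFun_iff_measure_inter_preimage_eq_mul.2 fun S _ hs =>
    h.measure_inter_preimage_eq_mul S hs

lemma IsBrownianReal.completion {W : ℝ≥0 → Ω → ℝ} (hW : IsBrownianReal W P) :
    IsBrownianReal (Ω := NullMeasurableSpace Ω P) W P.completion where
  hasLaw I := HasLaw.completion (Ω := Ω) (hW.hasLaw I)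
  cont := hW.cont

lemma IsPoissonProcess.completion {N : ℝ≥0 → Ω → ℕ} {r : ℝ≥0} (hN : IsPoissonProcess N r P) :
    IsPoissonProcess (Ω := NullMeasurableSpace Ω P) N r P.completion where
  zero := hN.zero
  indep n t ht := iIndepFun.completion (Ω := Ω) (hN.indep n t ht)
  law s t hst := HasLaw.completion (Ω := Ω) (hN.law s t hst)
  mono := hN.mono
  rightCont := hN.rightCont

/-- The input processes are put into the completed probability space, where they are measurable. -/
lemma Inputs.of_completion [IsProbabilityMeasure P] {r : ℝ≥0} {ξ : Ω → ℝ} {W : ℝ≥0 → Ω → ℝ}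
    {N : ℝ≥0 → Ω → ℕ} (hW : IsBrownianReal W P) (hN : IsPoissonProcess N r P)
    (hWN : IndepFun (fun ω t => W t ω) (fun ω t => N t ω) P) (hξ : AEMeasurable ξ P)
    (hξWN : IndepFun ξ (fun ω => ((fun t => W t ω), (fun t => N t ω))) P) :
    Inputs (Ω := NullMeasurableSpace Ω P) P.completion r ξ W N where
  measurable_start := hξ.nullMeasurable
  measurable_brownian t := (hW.aemeasurable t).nullMeasurable
  measurable_poisson t := by
    have h1 : AEMeasurable (N t) P := (hN.law 0 t zero_le).aemeasurable.congr (by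
      filter_upwards [hN.zero] with ω hω
      rw [hω, tsub_zero])
    exact h1.nullMeasurable
  brownian := IsBrownianReal.completion (Ω := Ω) hW
  poisson := hN.completion
  indep := IndepFun.completion (Ω := Ω) hWN
  indep_start := IndepFun.completion (Ω := Ω) hξWN

end

end ResettingBM

end

theorem mainTheorem9 {Ω : Type*} [MeasurableSpace Ω] (P : Measure Ω) [IsProbabilityMeasure P]
    (r : ℝ≥0) (hr : 0 < r)
    (W : ℝ≥0 → Ω → ℝ) (hW : IsBrownianReal W P)
    (N : ℝ≥0 → Ω → ℕ) (hN : ResettingBM.IsPoissonProcess N r P)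
    (hWN : IndepFun (fun ω t => W t ω) (fun ω t => N t ω) P)
    (μ : Measure ℝ) (hμ : μ = expMeasure (√(r : ℝ)))
    (ξ : Ω → ℝ) (hξ : HasLaw ξ μ P)
    (hξWN : IndepFun ξ (fun ω => ((fun t => W t ω), (fun t => N t ω))) P)
    (T : ℝ≥0) (hT : 0 < T)
    (XR : ℝ≥0 → Ω → ℝ) (hXR : XR = ResettingBM.timeReversal T (ResettingBM.resetRBM ξ W N))
    (κ κR : ℝ≥0 → ℝ → Measure ℝ) (hκ : κ = ResettingBM.forwardLaw P W N)
    (hκR : κR = ResettingBM.condLaw P XR) :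
    ResettingBM.IsMarkovWith P T XR κR ∧
    (∀ t ≤ T, ∀ A B : Set ℝ, MeasurableSet A → MeasurableSet B →
      ∫⁻ x in A, κR t x B ∂μ = ∫⁻ y in B, κ t y A ∂μ) ∧
    (∀ t ≤ T, ∀ f g : ℝ → ℝ, ResettingBM.BddMeas f → ResettingBM.BddMeas g →
      ∫ x, ResettingBM.semigroup κ t f x * g x ∂μ =
        ∫ x, f x * ResettingBM.semigroup κR t g x ∂μ) ∧
    (∀ f h g k : ℝ → ℝ, ResettingBM.IsGenerator μ (ResettingBM.semigroup κ) f h →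
      ResettingBM.IsGenerator μ (ResettingBM.semigroup κR) g k →
      ∫ x, h x * g x ∂μ = ∫ x, f x * k x ∂μ) ∧
    (∀ f : ℝ → ℝ, ResettingBM.DomA f →
      ResettingBM.IsGenerator μ (ResettingBM.semigroup κ) f (ResettingBM.opA r f)) := by
  subst hμ hXR hκ hκR
  have h := ResettingBM.Inputs.of_completion hW hN hWN hξ.aemeasurable hξWN
  have hξ' := ResettingBM.HasLaw.completion hξ
  -- the laws in the statement can be computed on the completed space
  have hκ : ResettingBM.forwardLaw P.completion W N = ResettingBM.forwardLaw P W N := by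
    ext1 t
    ext1 x
    exact ResettingBM.map_completion ((h.const x).measurable_resetRBM t)
  set Z := ResettingBM.timeReversal T (ResettingBM.resetRBM ξ W N) with hZ
  have hZm : ∀ u, Measurable (α := NullMeasurableSpace Ω P) (Z u) :=
    fun u => h.measurable_resetRBM (T - u)
  have hκR : ResettingBM.condLaw P.completion Z = ResettingBM.condLaw P Z := by
    ext1 t
    ext1 x
    exact congrArg (fun k : Kernel ℝ ℝ => k x)
      (ResettingBM.condDistrib_completion (hZm 0) (hZm t))
  rw [← hκ, ← hκR]
  have := ResettingBM.isProbabilityMeasure_expMeasure_sqrt hr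
  refine ⟨?_, fun t ht A B hA hB => h.setLIntegral_condLaw hr hξ' ht hA hB,
    fun t ht f g hf hg => h.integral_semigroup_mul hr hξ' ht (hf.memLp 2) (hg.memLp 2),
    fun f u g v hf hg => h.integral_generator_mul hr hξ' hT hf hg,
    fun f hf => h.isGenerator_opA hr hf⟩
  intro s t hst F hF g hg
  have hΦ : Measurable (α := NullMeasurableSpace Ω P) fun ω (u : Iic s) => Z u ω :=
    measurable_pi_lambda _ fun u => hZm u
  have hS : Measurable (ResettingBM.semigroup (ResettingBM.condLaw P.completion Z) t g) :=
    hg.1.stronglyMeasurable.integral_kernel.measurable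
  have h1 := h.isMarkovWith hr hξ' T s t hst F hF g hg
  exact (ResettingBM.integral_completion ((hF.1.comp hΦ).mul (hg.1.comp (hZm (s + t))))).symm.trans
    (h1.trans (ResettingBM.integral_completion ((hF.1.comp hΦ).mul (hS.comp (hZm s)))))
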